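/- Let $\Bbbk$ be a field and let $\mathcal C$ be a $\Bbbk$-linear abelian category in which every object has finite length. Let $(\Lambda,\le)$ be a poset in which every set $\{\mu\mid\mu\le\lambda\}$ is finite, and let $L_\lambda$ ($\lambda\in\Lambda$) be representatives of the isomorphism classes of simple objects of $\mathcal C$. Assume that $\mathcal C$ is a highest weight category with weight poset $\Lambda$: for every $\lambda\in\Lambda$, the object $L_\lambda$ has a projective cover $\Delta_\lambda\to L_\lambda$ and an injective hull $L_\lambda\to\nabla_\lambda$ in the Serre subcategory of $\mathcal C$ generated by $\{L_\mu\mid\mu\le\lambda\}$, $\mathrm{Hom}_{\mathcal C}(\Delta_\lambda,\nabla_\lambda)\cong\Bbbk$, and $\mathrm{Ext}^1_{\mathcal C}(\Delta_\lambda,\nabla_\mu)=\mathrm{Ext}^2_{\mathcal C}(\Delta_\lambda,\nabla_\mu)=0$ for all $\lambda,\mu\in\Lambda$. A $\Delta$-filtration (respectively $\nabla$-filtration) of an object is a finite filtration by subobjects, starting at $0$ and ending at the whole object, whose successive quotients are isomorphic to objects $\Delta_\lambda$ (respectively $\nabla_\lambda$); an object is tilting if it has both. For an object $M$, a minimal tilting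 complex of $M$ is a bounded cochain complex $T=(T_\bullet,d_\bullet)$ of tilting objects that is isomorphic to $M$ (placed in degree $0$) in the derived category $D^b(\mathcal C)$ and whose differentials all lie in the radical of the additive category $\mathrm{Tilt}(\mathcal C)$ of tilting objects, that is, $b\circ d_i\circ a$ lies in the Jacobson radical of $\mathrm{End}(N)$ for all tilting objects $N$ and all $a\colon N\to T_i$, $b\colon T_{i+1}\to N$. (Such a complex is unique up to isomorphism of complexes and is denoted $C_{\min}(M)$.) Let $M$ be an object of $\mathcal C$ and write $C_{\min}(M)=(T_\bullet,d_\bullet)$. (1) If $M\neq 0$, then the sets $\{d\ge 0\mid \mathrm{Ext}^d_{\mathcal C}(\Delta_\lambda,M)\ne0\text{ for some }\lambda\}$ and $\{d\ge 0\mid \mathrm{Ext}^d_{\mathcal C}(M,\nabla_\lambda)\neq0\text{ for some }\lambda\}$ have maxima, denoted $\dim_\nabla(M)$ and $\dim_\Delta(M)$ (the $\nabla$- and the $\Delta$-filtration dimension of $M$), and $$\dim_\nabla(M)=\max\{i\in\mathbb Z\mid T_i\ne0\},\qquad \dim_\Delta(M)=-\min\{i\in\mathbb Z\mid T_i\neq0\}.$$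 (2) $M$ (zero or not) admits a $\Delta$-filtration if and only if $T_i=0$ for all $i<0$. -/

import Mathlib

open CategoryTheory CategoryTheory.Limits

universe w w' v u

section General

variable {C : Type u} [Category.{v} C] [Abelian C]

/-- The Serre subcategory generated by the objects satisfying `S`: the intersection of all Serre
subcategories that contain them. -/
def serreGenerated (S : ObjectProperty C) : ObjectProperty C := fun X =>
  ∀ P : ObjectProperty C, P.IsSerreClass → S ≤ P → P X

/-- `π : X ⟶ L` is a projective cover of `L` in the Serre subcategory `P` of `C`: `X` is a
projective object of `P` and `π` is an essential epimorphism.  (Since the inclusion of a Serre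
subcategory is exact, epimorphisms in `P` are epimorphisms in `C` between objects of `P`.) -/
structure IsProjectiveCoverIn (P : ObjectProperty C) {X L : C} (π : X ⟶ L) : Prop where
  mem : P X
  lift : ∀ ⦃Y Z : C⦄ (e : Y ⟶ Z) (f : X ⟶ Z), P Y → P Z → Epi e → ∃ g : X ⟶ Y, g ≫ e = f
  epi : Epi π
  essential : ∀ ⦃Y : C⦄ (f : Y ⟶ X), P Y → Epi (f ≫ π) → Epi f

/-- `ι : L ⟶ X` is an injective hull of `L` in the Serre subcategory `P` of `C`: `X` is an
injective object of `P` and `ι` is an essential monomorphism. -/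
structure IsInjectiveHullIn (P : ObjectProperty C) {L X : C} (ι : L ⟶ X) : Prop where
  mem : P X
  extend : ∀ ⦃Y Z : C⦄ (m : Y ⟶ Z) (f : Y ⟶ X), P Y → P Z → Mono m → ∃ g : Z ⟶ X, m ≫ g = f
  mono : Mono ι
  essential : ∀ ⦃Y : C⦄ (f : X ⟶ Y), P Y → Mono (ι ≫ f) → Mono f

/-- `M` has a finite filtration `0 = F 0 ⊆ F 1 ⊆ ⋯ ⊆ F r = M` by subobjects such that every
quotient `F (i + 1) / F i`, for `i < r`, is isomorphic to one of the objects `S l`. -/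
def HasFiltrationBy {Λ : Type*} (S : Λ → C) (M : C) : Prop :=
  ∃ (r : ℕ) (F : ℕ → Subobject M) (hF : Monotone F), F 0 = ⊥ ∧ F r = ⊤ ∧
    ∀ i < r, ∃ l : Λ,
      Nonempty (cokernel (Subobject.ofLE (F i) (F (i + 1)) (hF i.le_succ)) ≅ S l)

/-- The morphism `f : A ⟶ B` belongs to the radical of the full additive subcategory of `C` on the
objects satisfying `P` (to which `A` and `B` are meant to belong): for every object `N` of the
subcategory and all `a : N ⟶ A` and `b : B ⟶ N`, the composite lies in the Jacobson radical of
the endomorphism ring of `N`. -/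
def InRadical (P : ObjectProperty C) {A B : C} (f : A ⟶ B) : Prop :=
  ∀ ⦃N : C⦄, P N → ∀ (a : N ⟶ A) (b : B ⟶ N), (a ≫ f ≫ b : End N) ∈ Ring.jacobson (End N)

end General

/-- The structure of a highest weight category with weight poset `Λ` on the `k`-linear abelian
category `C`, with chosen simple objects `L l`, standard objects `Δ l` and costandard
objects `nabla l`. -/
structure HighestWeightCategory (k : Type*) [Field k] (C : Type u) [Category.{v} C] [Abelian C]
    [Linear k C] [HasExt.{w} C] (Λ : Type*) [PartialOrder Λ] where
  /-- every object has finite length -/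
  finiteLength : ∀ X : C, IsArtinianObject X ∧ IsNoetherianObject X
  /-- the weight poset is lower finite -/
  lowerFinite : ∀ l : Λ, (Set.Iic l).Finite
  /-- representatives of the isomorphism classes of simple objects -/
  L : Λ → C
  simple_L : ∀ l, Simple (L l)
  exists_iso_L : ∀ S : C, Simple S → ∃ l, Nonempty (S ≅ L l)
  L_injective : ∀ l m, Nonempty (L l ≅ L m) → l = m
  /-- the standard objects -/
  Δ : Λ → C
  /-- the costandard objects -/
  nabla : Λ → C
  π : ∀ l, Δ l ⟶ L l
  ι : ∀ l, L l ⟶ nabla l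
  /-- `Δ l` is a projective cover of `L l` in the truncation of `C` to the weights `≤ l` -/
  projectiveCover : ∀ l,
    IsProjectiveCoverIn (serreGenerated fun X => ∃ m ≤ l, Nonempty (X ≅ L m)) (π l)
  /-- `nabla l` is an injective hull of `L l` in the truncation of `C` to the weights `≤ l` -/
  injectiveHull : ∀ l,
    IsInjectiveHullIn (serreGenerated fun X => ∃ m ≤ l, Nonempty (X ≅ L m)) (ι l)
  hom_Δ_nabla : ∀ l, Nonempty ((Δ l ⟶ nabla l) ≃ₗ[k] k)
  ext_one : ∀ l m, Subsingleton (Abelian.Ext (Δ l) (nabla m) 1)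
  ext_two : ∀ l m, Subsingleton (Abelian.Ext (Δ l) (nabla m) 2)

namespace HighestWeightCategory

variable {k : Type*} [Field k] {C : Type u} [Category.{v} C] [Abelian C] [Linear k C]
  [HasExt.{w} C] {Λ : Type*} [PartialOrder Λ] (H : HighestWeightCategory k C Λ)

/-- `M` admits a `Δ`-filtration. -/
def HasDeltaFiltration (M : C) : Prop := HasFiltrationBy H.Δ M

/-- `M` admits a `∇`-filtration. -/
def HasNablaFiltration (M : C) : Prop := HasFiltrationBy H.nabla M

/-- The tilting objects, as a full subcategory of `C`. -/
def tilting : ObjectProperty C := fun M => H.HasDeltaFiltration M ∧ H.HasNablaFiltration M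

/-- The degrees `d` in which `Ext^d(Δ l, M)` is non-zero for some weight `l`. -/
def nablaDegrees (M : C) : Set ℕ := {d | ∃ l, Nontrivial (Abelian.Ext (H.Δ l) M d)}

/-- The degrees `d` in which `Ext^d(M, nabla l)` is non-zero for some weight `l`. -/
def deltaDegrees (M : C) : Set ℕ := {d | ∃ l, Nontrivial (Abelian.Ext M (H.nabla l) d)}

/-- The `∇`-filtration dimension (meaningful when the set of degrees has a maximum). -/
noncomputable def nablaDim (M : C) : ℕ := sSup (H.nablaDegrees M)

/-- The `Δ`-filtration dimension (meaningful when the set of degrees has a maximum). -/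
noncomputable def deltaDim (M : C) : ℕ := sSup (H.deltaDegrees M)

/-- `T` is a minimal tilting complex of `M`: a bounded complex of tilting objects, minimal in the
category of tilting objects, and isomorphic in the derived category to `M` placed in degree `0`. -/
structure IsMinimalTiltingComplex [HasDerivedCategory.{w'} C] (M : C) (T : CochainComplex C ℤ) :
    Prop where
  tilting : ∀ i, H.tilting (T.X i)
  bounded : ∃ a b : ℤ, ∀ i, (i < a ∨ b < i) → IsZero (T.X i)
  minimal : ∀ i, InRadical H.tilting (T.d i (i + 1))
  iso : Nonempty (DerivedCategory.Q.obj T ≅ (DerivedCategory.singleFunctor C 0).obj M)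

end HighestWeightCategory

/-! The proof rests on a vanishing theorem and a splitting argument.

Vanishing: `Ext^n(D, N) = 0` for all `n ≥ 1` if `D` has a `Δ`-filtration and `N` a `∇`-filtration,
although only `n = 1, 2` is assumed. Call `N` `nablaAcyclic` if degrees 1 and 2 vanish against every
`Δ l`, and `D` `deltaAcyclic` if they vanish against all such `N`. Induction on weights shows that
every object is a quotient of a `deltaAcyclic` object by a `nablaAcyclic` one
(`hasDeltaApproximation`). A class in `Ext^(n+1)(X, N)` dies on some epimorphism `Y ⟶ X`, hence on a
`deltaAcyclic` cover `D` of `Y`; it therefore comes from `Ext^n` of the kernel of `D ⟶ X`, which is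
`deltaAcyclic` if `X` is (`extVanish_of_acyclic`).

Splitting: the terms of `T` thus have no higher `Ext` from any `Δ l`, and its only cohomology is
`M`. Let `n` be its top degree; `n ≥ 0` if `M ≠ 0`. Dimension shifting along the cycles kills
`Ext^d(Δ l, M)` for `d > n`. If `n > 0` and `Ext^n(Δ l, M)` vanished for all `l`, shifting would
give `Ext^1(Δ l, Z) = 0` for the cycles `Z` in degree `n - 1`; the last differential, an epimorphism
with kernel `Z`, would split, which the radical condition forbids (`isZero_last`). If `n = 0`, some
`Hom(Δ l, M)` is non-zero. The `Δ`-dimension is dual.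

Part (2) follows with the criterion that `Ext^1(M, nabla l) = 0` for all `l` yields a `Δ`-filtration
(`hasDeltaFiltration_of_extVanish`). -/

open scoped ZeroObject

/-! ### Vanishing of `Ext` along long exact sequences -/

section ExtVanishing

open Abelian

variable {C : Type u} [Category.{v} C] [Abelian C] [HasExt.{w} C]

/-- The vanishing of `Ext^n(X, Y)`. -/
def ExtVanish (n : ℕ) (X Y : C) : Prop := ∀ e : Ext X Y n, e = 0

lemma extVanish_iff_subsingleton {n : ℕ} {X Y : C} :
    ExtVanish n X Y ↔ Subsingleton (Ext X Y n) :=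
  ⟨fun h => ⟨fun a b => (h a).trans (h b).symm⟩, fun _ e => Subsingleton.elim e 0⟩

lemma not_extVanish_iff_nontrivial {n : ℕ} {X Y : C} :
    ¬ ExtVanish n X Y ↔ Nontrivial (Ext X Y n) := by
  rw [extVanish_iff_subsingleton, not_subsingleton_iff_nontrivial]

lemma extVanish_zero_iff {X Y : C} : ExtVanish 0 X Y ↔ ∀ f : X ⟶ Y, f = 0 := by
  refine ⟨fun h f => (Ext.mk₀_eq_zero_iff f).1 (h _), fun h e => ?_⟩
  obtain ⟨f, rfl⟩ := Ext.addEquiv₀.symm.surjective e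
  simp [h f]

lemma extVanish_of_isZero_right {n : ℕ} {X Y : C} (h : IsZero Y) : ExtVanish n X Y := fun e => by
  rw [← Ext.comp_mk₀_id e, h.eq_of_src (𝟙 Y) 0, Ext.mk₀_zero, Ext.comp_zero]

lemma extVanish_of_isZero_left {n : ℕ} {X Y : C} (h : IsZero X) : ExtVanish n X Y := fun e => by
  rw [← Ext.mk₀_id_comp e, h.eq_of_src (𝟙 X) 0, Ext.mk₀_zero, Ext.zero_comp]

lemma ExtVanish.of_retract_left {n : ℕ} {X X' Y : C} (h : ExtVanish n X Y) (i : X' ⟶ X)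
    (r : X ⟶ X') (hir : i ≫ r = 𝟙 X') : ExtVanish n X' Y := fun e => by
  rw [← Ext.mk₀_id_comp e, ← hir, ← Ext.mk₀_comp_mk₀_assoc, h ((Ext.mk₀ r).comp e _), Ext.comp_zero]

lemma ExtVanish.of_iso_left {n : ℕ} {X X' Y : C} (h : ExtVanish n X Y) (e : X' ≅ X) :
    ExtVanish n X' Y := h.of_retract_left e.hom e.inv e.hom_inv_id

lemma ExtVanish.of_iso_right {n : ℕ} {X Y Y' : C} (h : ExtVanish n X Y) (e : Y' ≅ Y) :
    ExtVanish n X Y' := fun a => by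
  rw [← Ext.comp_mk₀_id a, ← e.hom_inv_id, ← Ext.mk₀_comp_mk₀, ← Ext.comp_assoc_of_third_deg_zero,
    h (a.comp _ _), Ext.zero_comp]

variable {S : ShortComplex C} (hS : S.ShortExact) {n : ℕ}

include hS

lemma ExtVanish.cov_mid {X : C} (h₁ : ExtVanish n X S.X₁) (h₃ : ExtVanish n X S.X₃) :
    ExtVanish n X S.X₂ := fun e => by
  obtain ⟨a, rfl⟩ := Ext.covariant_sequence_exact₂ X hS e (h₃ _)
  rw [h₁ a, Ext.zero_comp]

lemma ExtVanish.cov_right {X : C} (h₂ : ExtVanish n X S.X₂) (h₁ : ExtVanish (n + 1) X S.X₁) :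
    ExtVanish n X S.X₃ := fun e => by
  obtain ⟨a, rfl⟩ := Ext.covariant_sequence_exact₃ X hS e rfl (h₁ _)
  rw [h₂ a, Ext.zero_comp]

lemma ExtVanish.cov_left {X : C} (h₃ : ExtVanish n X S.X₃) (h₂ : ExtVanish (n + 1) X S.X₂) :
    ExtVanish (n + 1) X S.X₁ := fun e => by
  obtain ⟨a, rfl⟩ := Ext.covariant_sequence_exact₁ X hS e (h₂ _) rfl
  rw [h₃ a, Ext.zero_comp]

lemma ExtVanish.contra_mid {Y : C} (h₁ : ExtVanish n S.X₁ Y) (h₃ : ExtVanish n S.X₃ Y) :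
    ExtVanish n S.X₂ Y := fun e => by
  obtain ⟨a, rfl⟩ := Ext.contravariant_sequence_exact₂ hS Y e (h₁ _)
  rw [h₃ a, Ext.comp_zero]

lemma ExtVanish.contra_left {Y : C} (h₂ : ExtVanish n S.X₂ Y) (h₃ : ExtVanish (n + 1) S.X₃ Y) :
    ExtVanish n S.X₁ Y := fun e => by
  obtain ⟨a, rfl⟩ := Ext.contravariant_sequence_exact₁ hS Y e (add_comm 1 n) (h₃ _)
  rw [h₂ a, Ext.comp_zero]

lemma ExtVanish.contra_right {Y : C} (h₁ : ExtVanish n S.X₁ Y) (h₂ : ExtVanish (n + 1) S.X₂ Y) :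
    ExtVanish (n + 1) S.X₃ Y := fun e => by
  obtain ⟨a, rfl⟩ := Ext.contravariant_sequence_exact₃ hS Y e (h₂ _) (add_comm 1 n)
  rw [h₁ a, Ext.comp_zero]

/-- Morphisms lift along the epimorphism of a short exact sequence if the obstruction
group vanishes. -/
lemma ExtVanish.exists_lift {X : C} (h : ExtVanish 1 X S.X₁) (f : X ⟶ S.X₃) :
    ∃ g : X ⟶ S.X₂, g ≫ S.g = f := by
  obtain ⟨a, ha⟩ := Ext.covariant_sequence_exact₃ X hS (Ext.mk₀ f) rfl (h _)
  obtain ⟨g, rfl⟩ := (Ext.mk₀_bijective _ _).2 a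
  exact ⟨g, (Ext.mk₀_bijective _ _).1 (by simpa using ha)⟩

/-- Morphisms extend along the monomorphism of a short exact sequence if the obstruction
group vanishes. -/
lemma ExtVanish.exists_extend {Y : C} (h : ExtVanish 1 S.X₃ Y) (f : S.X₁ ⟶ Y) :
    ∃ g : S.X₂ ⟶ Y, S.f ≫ g = f := by
  obtain ⟨a, ha⟩ := Ext.contravariant_sequence_exact₁ hS Y (Ext.mk₀ f) rfl (h _)
  obtain ⟨g, rfl⟩ := (Ext.mk₀_bijective _ _).2 a
  exact ⟨g, (Ext.mk₀_bijective _ _).1 (by simpa using ha)⟩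

end ExtVanishing

/-! ### Effaceability of `Ext` in positive degrees -/

section Effaceable

open Abelian DerivedCategory

variable {C : Type u} [Category.{v} C] [Abelian C]

/-- A quasi-isomorphism onto a single complex is an epimorphism on the cycles. -/
lemma epi_iCycles_comp_of_quasiIso_single {X : C} {K : CochainComplex C ℤ}
    (s : K ⟶ (HomologicalComplex.single C _ 0).obj X) [QuasiIso s] :
    Epi (K.iCycles 0 ≫ s.f 0 ≫ (HomologicalComplex.singleObjXSelf _ 0 X).hom) := by
  have h : K.iCycles 0 ≫ s.f 0 ≫ (HomologicalComplex.singleObjXSelf _ 0 X).hom =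
      K.homologyπ 0 ≫ HomologicalComplex.homologyMap s 0 ≫
        (HomologicalComplex.singleObjHomologySelfIso _ 0 X).hom := by
    rw [HomologicalComplex.homologyπ_naturality_assoc,
      HomologicalComplex.homologyπ_singleObjHomologySelfIso_hom,
      HomologicalComplex.singleObjCyclesSelfIso_hom, HomologicalComplex.cyclesMap_i_assoc]
  rw [h]
  infer_instance

variable [HasExt.{w} C]

/-- Elements of positive degree in `Ext` are effaceable. -/
lemma exists_epi_comp_eq_zero {X Y : C} {n : ℕ} (e : Ext X Y (n + 1)) :
    ∃ (Z : C) (p : Z ⟶ X), Epi p ∧ (Ext.mk₀ p).comp e (zero_add _) = 0 := by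
  let := HasDerivedCategory.standard C
  let φ : Q.obj ((HomologicalComplex.single C (ComplexShape.up ℤ) 0).obj X) ⟶
      Q.obj (((HomologicalComplex.single C (ComplexShape.up ℤ) 0).obj Y)⟦((n + 1 : ℕ) : ℤ)⟧) :=
    e.hom ≫ (Q.commShiftIso ((n + 1 : ℕ) : ℤ)).inv.app _
  -- Write the class as a fraction: `s` inverted, then a chain map `g`. The degree-0 cycles of `K`
  -- cover `X`, and `g` is zero on them because the shift of `Y` has no term in degree 0.
  obtain ⟨K, s, hs, g, hg⟩ := right_fac φ
  have : QuasiIso s := (isIso_Q_map_iff_quasiIso C s).1 hs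
  let p : K.cycles 0 ⟶ X := K.iCycles 0 ≫ s.f 0 ≫ (HomologicalComplex.singleObjXSelf _ 0 X).hom
  refine ⟨_, p, epi_iCycles_comp_of_quasiIso_single s, ?_⟩
  let j : (HomologicalComplex.single C (ComplexShape.up ℤ) 0).obj (K.cycles 0) ⟶ K :=
    HomologicalComplex.mkHomFromSingle (K.iCycles 0) (fun k _ => K.iCycles_d 0 k)
  have hjs : j ≫ s = (HomologicalComplex.single C (ComplexShape.up ℤ) 0).map p := by
    apply HomologicalComplex.from_single_hom_ext
    simp [j, p, HomologicalComplex.single_map_f_self]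
  have hjg : j ≫ g = 0 := by
    apply HomologicalComplex.from_single_hom_ext
    have h0 : (0 : ℤ) + ((n + 1 : ℕ) : ℤ) ≠ 0 := by lia
    exact IsZero.eq_of_tgt (HomologicalComplex.isZero_single_obj_X (ComplexShape.up ℤ) _ Y _ h0) _ _
  have hQ : Q.map ((HomologicalComplex.single C (ComplexShape.up ℤ) 0).map p) ≫ φ = 0 := by
    rw [hg, ← hjs, Q.map_comp, Category.assoc, IsIso.hom_inv_id_assoc, ← Q.map_comp, hjg,
      Q.map_zero]
  ext
  rw [← Ext.singleFunctor_map_comp_hom, Ext.zero_hom]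
  refine (cancel_mono ((Q.commShiftIso ((n + 1 : ℕ) : ℤ)).inv.app
    ((HomologicalComplex.single C (ComplexShape.up ℤ) 0).obj Y))).1 ?_
  exact ((Category.assoc _ _ _).trans hQ).trans Limits.zero_comp.symm

end Effaceable

/-! ### Kernels, cokernels, pushouts and pullbacks of short exact sequences -/

section Snake

variable {C : Type u} [Category.{v} C] [Abelian C]

/-- The kernels of a morphism of short exact sequences form a short exact sequence if the
left component is an epimorphism. -/
lemma exists_shortExact_kernels {S₁ S₂ : ShortComplex C} (h₁ : S₁.ShortExact)
    (h₂ : S₂.ShortExact) (φ : S₁ ⟶ S₂) [Epi φ.τ₁] :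
    ∃ K : ShortComplex C, K.ShortExact ∧ Nonempty (K.X₁ ≅ kernel φ.τ₁) ∧
      Nonempty (K.X₂ ≅ kernel φ.τ₂) ∧ Nonempty (K.X₃ ≅ kernel φ.τ₃) := by
  let S : ShortComplex.SnakeInput C :=
    { L₀ := kernel φ, L₁ := S₁, L₂ := S₂, L₃ := cokernel φ
      v₀₁ := kernel.ι φ, v₁₂ := φ, v₂₃ := cokernel.π φ
      h₀ := kernelIsKernel φ, h₃ := cokernelIsCokernel φ
      L₁_exact := h₁.exact, epi_L₁_g := h₁.epi_g, L₂_exact := h₂.exact, mono_L₂_f := h₂.mono_f }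
  have h0 : IsZero S.L₃.X₁ := by
    have : Epi S.v₁₂.τ₁ := inferInstanceAs (Epi φ.τ₁)
    have := S.epi_v₂₃_τ₁
    exact (IsZero.iff_id_eq_zero _).2 (by
      rw [← cancel_epi S.v₂₃.τ₁, ← cancel_epi S.v₁₂.τ₁]; simp)
  have e : Epi S.L₀.g := S.L₁'_exact.epi_f (h0.eq_of_tgt _ _)
  have m : Mono S.L₀.f := by
    have : Mono S.L₁.f := h₁.mono_f
    exact S.mono_L₀_f
  exact ⟨S.L₀, { exact := S.L₀_exact },
    ⟨S.h₀τ₁.conePointUniqueUpToIso (limit.isLimit _)⟩,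
    ⟨S.h₀τ₂.conePointUniqueUpToIso (limit.isLimit _)⟩,
    ⟨S.h₀τ₃.conePointUniqueUpToIso (limit.isLimit _)⟩⟩

/-- The cokernels of a morphism of short exact sequences form a short exact sequence if the
right component is a monomorphism. -/
lemma exists_shortExact_cokernels {S₁ S₂ : ShortComplex C} (h₁ : S₁.ShortExact)
    (h₂ : S₂.ShortExact) (φ : S₁ ⟶ S₂) [Mono φ.τ₃] :
    ∃ K : ShortComplex C, K.ShortExact ∧ Nonempty (K.X₁ ≅ cokernel φ.τ₁) ∧
      Nonempty (K.X₂ ≅ cokernel φ.τ₂) ∧ Nonempty (K.X₃ ≅ cokernel φ.τ₃) := by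
  let S : ShortComplex.SnakeInput C :=
    { L₀ := kernel φ, L₁ := S₁, L₂ := S₂, L₃ := cokernel φ
      v₀₁ := kernel.ι φ, v₁₂ := φ, v₂₃ := cokernel.π φ
      h₀ := kernelIsKernel φ, h₃ := cokernelIsCokernel φ
      L₁_exact := h₁.exact, epi_L₁_g := h₁.epi_g, L₂_exact := h₂.exact, mono_L₂_f := h₂.mono_f }
  have h0 : IsZero S.L₀.X₃ := by
    have : Mono S.v₁₂.τ₃ := inferInstanceAs (Mono φ.τ₃)
    have := S.mono_v₀₁_τ₃
    exact (IsZero.iff_id_eq_zero _).2 (by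
      rw [← cancel_mono S.v₀₁.τ₃, ← cancel_mono S.v₁₂.τ₃]; simp)
  have m : Mono S.L₃.f := S.L₂'_exact.mono_g (h0.eq_of_src _ _)
  have e : Epi S.L₃.g := by
    have : Epi S.L₂.g := h₂.epi_g
    exact S.epi_L₃_g
  exact ⟨S.L₃, { exact := S.L₃_exact },
    ⟨S.h₃τ₁.coconePointUniqueUpToIso (colimit.isColimit _)⟩,
    ⟨S.h₃τ₂.coconePointUniqueUpToIso (colimit.isColimit _)⟩,
    ⟨S.h₃τ₃.coconePointUniqueUpToIso (colimit.isColimit _)⟩⟩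

lemma shortExact_kernel {X Y : C} (f : X ⟶ Y) [Epi f] :
    (ShortComplex.mk _ _ (kernel.condition f)).ShortExact :=
  { exact := ShortComplex.exact_kernel f }

lemma shortExact_cokernel {X Y : C} (f : X ⟶ Y) [Mono f] :
    (ShortComplex.mk _ _ (cokernel.condition f)).ShortExact :=
  { exact := ShortComplex.exact_cokernel f }

/-- The pushout of a short exact sequence along a morphism from its left term. -/
lemma exists_pushout_shortExact {S : ShortComplex C} (hS : S.ShortExact) {A : C}
    (f : S.X₁ ⟶ A) : ∃ (P : C) (i : A ⟶ P) (p : P ⟶ S.X₃) (g : S.X₂ ⟶ P) (w : i ≫ p = 0),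
      (ShortComplex.mk i p w).ShortExact ∧ IsPushout S.f f g i ∧ g ≫ p = S.g ∧
        (Mono f → Mono g) := by
  have := hS.mono_f
  have := hS.epi_g
  let p : pushout S.f f ⟶ S.X₃ := pushout.desc S.g 0 (by simp)
  have hp : pushout.inl S.f f ≫ p = S.g := pushout.inl_desc _ _ _
  have w : pushout.inr S.f f ≫ p = 0 := pushout.inr_desc _ _ _
  have : Epi (pushout.inl S.f f ≫ p) := by rw [hp]; infer_instance
  have : Epi p := epi_of_epi (pushout.inl S.f f) p
  refine ⟨_, pushout.inr S.f f, p, pushout.inl _ _, w, { exact := ?_ },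
    IsPushout.of_hasPushout _ _, hp, fun _ => inferInstance⟩
  refine ShortComplex.exact_of_g_is_cokernel _
    (CokernelCofork.IsColimit.ofπ' _ _ (fun {Z} k hk => ?_))
  have h0 : S.f ≫ pushout.inl S.f f ≫ k = 0 := by
    rw [pushout.condition_assoc]; erw [hk]; simp
  refine ⟨hS.exact.desc (pushout.inl S.f f ≫ k) h0, ?_⟩
  apply pushout.hom_ext
  · rw [reassoc_of% hp, ShortComplex.Exact.g_desc]
  · erw [reassoc_of% w, hk]; simp

/-- The pullback of a short exact sequence along a morphism to its right term. -/
lemma exists_pullback_shortExact {S : ShortComplex C} (hS : S.ShortExact) {A : C}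
    (f : A ⟶ S.X₃) : ∃ (P : C) (i : S.X₁ ⟶ P) (p : P ⟶ A) (g : P ⟶ S.X₂) (w : i ≫ p = 0),
      (ShortComplex.mk i p w).ShortExact ∧ IsPullback g p S.g f ∧ i ≫ g = S.f ∧
      (Mono f → Mono g) ∧ (Epi f → Epi g) := by
  have := hS.mono_f
  have := hS.epi_g
  let i : S.X₁ ⟶ pullback S.g f := pullback.lift S.f 0 (by simp)
  have hi : i ≫ pullback.fst S.g f = S.f := pullback.lift_fst _ _ _
  have w : i ≫ pullback.snd S.g f = 0 := pullback.lift_snd _ _ _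
  have : Mono (i ≫ pullback.fst S.g f) := by rw [hi]; infer_instance
  have : Mono i := mono_of_mono i (pullback.fst S.g f)
  refine ⟨_, i, pullback.snd S.g f, pullback.fst _ _, w, { exact := ?_ },
    IsPullback.of_hasPullback _ _, hi, fun _ => inferInstance, fun _ => inferInstance⟩
  refine ShortComplex.exact_of_f_is_kernel _
    (KernelFork.IsLimit.ofι' _ _ (fun {Z} k hk => ?_))
  have h0 : (k ≫ pullback.fst S.g f) ≫ S.g = 0 := by
    rw [Category.assoc, pullback.condition]; erw [reassoc_of% hk]; simp
  refine ⟨hS.exact.lift (k ≫ pullback.fst S.g f) h0, ?_⟩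
  apply pullback.hom_ext
  · rw [Category.assoc, hi, ShortComplex.Exact.lift_f]
  · erw [Category.assoc, w, hk]; simp

end Snake

/-! ### `Ext^1` as classes of extensions -/

section ExtClass

open Abelian

variable {C : Type u} [Category.{v} C] [Abelian C] [HasExt.{w} C]

/-- Every element of `Ext¹` is the class of a short exact sequence. -/
lemma exists_shortExact_extClass_eq {X Y : C} (e : Ext X Y 1) :
    ∃ (E : C) (i : Y ⟶ E) (p : E ⟶ X) (w : i ≫ p = 0)
      (h : (ShortComplex.mk i p w).ShortExact), h.extClass = e := by
  -- Since `p` effaces `e`, the class `e` is the pushout along some `f` of the class of the kernel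
  -- sequence of `p`.
  obtain ⟨Z, p, _, hp⟩ := exists_epi_comp_eq_zero e
  obtain ⟨a, ha⟩ := Ext.contravariant_sequence_exact₃ (shortExact_kernel p) Y e hp (add_zero 1)
  obtain ⟨f, rfl⟩ := (Ext.mk₀_bijective _ _).2 a
  obtain ⟨P, i, q, g, w, h, hpo, hq, -⟩ := exists_pushout_shortExact (shortExact_kernel p) f
  refine ⟨P, i, q, w, h, ?_⟩
  have := ShortComplex.ShortExact.extClass_naturality (shortExact_kernel p) h
    { τ₁ := f, τ₂ := g, τ₃ := 𝟙 _, comm₁₂ := hpo.w.symm, comm₂₃ := by simpa using hq }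
  simp only [Ext.mk₀_id_comp] at this
  rw [← this, ← ha]

/-- Morphisms between the outer terms of short exact sequences which are compatible with their
classes extend to a morphism of short exact sequences. -/
lemma exists_hom_of_extClass {S S' : ShortComplex C} (hS : S.ShortExact) (hS' : S'.ShortExact)
    (a : S.X₁ ⟶ S'.X₁) (c : S.X₃ ⟶ S'.X₃)
    (h : hS.extClass.comp (Ext.mk₀ a) (add_zero 1) =
      (Ext.mk₀ c).comp hS'.extClass (zero_add 1)) :
    ∃ φ : S ⟶ S', φ.τ₁ = a ∧ φ.τ₃ = c := by
  have := hS.epi_g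
  obtain ⟨x, hx⟩ := Ext.contravariant_sequence_exact₁ hS S'.X₂ (Ext.mk₀ (a ≫ S'.f))
    (add_zero 1) (by
      rw [← Ext.mk₀_comp_mk₀, ← Ext.comp_assoc_of_third_deg_zero, h,
        Ext.comp_assoc_of_third_deg_zero, hS'.extClass_comp, Ext.comp_zero])
  obtain ⟨b₀, rfl⟩ := (Ext.mk₀_bijective _ _).2 x
  have hb₀ : S.f ≫ b₀ = a ≫ S'.f := (Ext.mk₀_bijective _ _).1 (by simpa using hx)
  -- The map `c₀` induced by `b₀` need not be `c`, but `c - c₀` pulls the class of `S'` back to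
  -- zero. It therefore lifts through `S'.g`, and the lift `t` corrects `b₀`.
  obtain ⟨c₀, hc₀⟩ : ∃ c₀, S.g ≫ c₀ = b₀ ≫ S'.g :=
    ⟨hS.exact.desc (b₀ ≫ S'.g) (by rw [reassoc_of% hb₀, S'.zero, comp_zero]),
      hS.exact.g_desc _ _⟩
  have h₀ := ShortComplex.ShortExact.extClass_naturality hS hS'
    { τ₁ := a, τ₂ := b₀, τ₃ := c₀, comm₁₂ := hb₀.symm, comm₂₃ := hc₀.symm }
  obtain ⟨y, hy⟩ := Ext.covariant_sequence_exact₃ S.X₃ hS' (Ext.mk₀ (c - c₀)) (zero_add 1) (by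
    rw [sub_eq_add_neg, Ext.mk₀_add, Ext.add_comp, Ext.mk₀_neg, Ext.neg_comp, ← h]
    simp [h₀])
  obtain ⟨t, rfl⟩ := (Ext.mk₀_bijective _ _).2 y
  have ht : t ≫ S'.g = c - c₀ := (Ext.mk₀_bijective _ _).1 (by simpa using hy)
  exact ⟨{ τ₁ := a, τ₂ := b₀ + S.g ≫ t, τ₃ := c
           comm₁₂ := by simp [hb₀]
           comm₂₃ := by simp [ht, hc₀] }, rfl, rfl⟩

/-- If `Ext²(X, ker p)` vanishes for an epimorphism `p : A' ⟶ A`, then extensions of `X` by `A`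
lift to extensions by `A'`. More generally, this holds after pulling back along `c`. -/
lemma exists_lift_extension {S : ShortComplex C} (hS : S.ShortExact) {A' D : C}
    (p : A' ⟶ S.X₁) [Epi p] (c : D ⟶ S.X₃) (h : ExtVanish 2 D (kernel p)) :
    ∃ (E : C) (i : A' ⟶ E) (q : E ⟶ D) (w : i ≫ q = 0) (_ : (ShortComplex.mk i q w).ShortExact)
      (φ : ShortComplex.mk i q w ⟶ S), φ.τ₁ = p ∧ φ.τ₃ = c := by
  obtain ⟨e, he⟩ := Ext.covariant_sequence_exact₃ D (shortExact_kernel p)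
    ((Ext.mk₀ c).comp hS.extClass (zero_add 1)) rfl (h _)
  obtain ⟨E, i, q, w, hE, rfl⟩ := exists_shortExact_extClass_eq e
  obtain ⟨φ, h₁, h₃⟩ := exists_hom_of_extClass hE hS p c he
  exact ⟨E, i, q, w, hE, φ, h₁, h₃⟩

/-- If `Ext²(coker m, Y)` vanishes for a monomorphism `m : X ⟶ X'`, then extensions of `X` by `Y`
are restricted from extensions of `X'`. More generally, this holds after pushing out along `a`. -/
lemma exists_extend_extension {S : ShortComplex C} (hS : S.ShortExact) {X' N : C}
    (a : S.X₁ ⟶ N) (m : S.X₃ ⟶ X') [Mono m] (h : ExtVanish 2 (cokernel m) N) :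
    ∃ (E : C) (i : N ⟶ E) (q : E ⟶ X') (w : i ≫ q = 0) (_ : (ShortComplex.mk i q w).ShortExact)
      (φ : S ⟶ ShortComplex.mk i q w), φ.τ₁ = a ∧ φ.τ₃ = m := by
  obtain ⟨e, he⟩ := Ext.contravariant_sequence_exact₁ (shortExact_cokernel m) N
    (hS.extClass.comp (Ext.mk₀ a) (add_zero 1)) rfl (h _)
  obtain ⟨E, i, q, w, hE, rfl⟩ := exists_shortExact_extClass_eq e
  obtain ⟨φ, h₁, h₃⟩ := exists_hom_of_extClass hS hE a m he.symm
  exact ⟨E, i, q, w, hE, φ, h₁, h₃⟩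

end ExtClass

/-! ### Dévissage along simple subquotients -/

section Devissage

variable {C : Type u} [Category.{v} C] [Abelian C]

/-- `S` is a quotient of a subobject of `X`. -/
def IsSubquotient (S X : C) : Prop := ∃ (A : C) (i : A ⟶ X) (p : A ⟶ S), Mono i ∧ Epi p

omit [Abelian C] in
lemma IsSubquotient.of_mono {S X Y : C} (h : IsSubquotient S X) (f : X ⟶ Y) [Mono f] :
    IsSubquotient S Y := by
  obtain ⟨A, i, p, _, _⟩ := h
  exact ⟨A, i ≫ f, p, inferInstance, inferInstance⟩

lemma IsSubquotient.of_epi {S X Y : C} (h : IsSubquotient S Y) (f : X ⟶ Y) [Epi f] :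
    IsSubquotient S X := by
  obtain ⟨A, i, p, _, _⟩ := h
  exact ⟨pullback f i, pullback.fst f i, pullback.snd f i ≫ p, inferInstance, inferInstance⟩

/-- A simple subquotient of an extension is a subquotient of one of the outer terms. -/
lemma IsSubquotient.of_shortExact {T : C} [Simple T] {S : ShortComplex C} (hS : S.ShortExact)
    (h : IsSubquotient T S.X₂) : IsSubquotient T S.X₁ ∨ IsSubquotient T S.X₃ := by
  obtain ⟨A, i, p, _, _⟩ := h
  have := hS.mono_f
  let κ := kernel.ι (i ≫ S.g)
  -- As `T` is simple, the part of `A` lying in `S.X₁` either maps to zero in `T`, so that `p`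
  -- factors through the image of `A` in `S.X₃`, or maps onto `T`.
  by_cases h0 : κ ≫ p = 0
  · right
    let e := Abelian.factorThruImage (i ≫ S.g)
    have he : e ≫ Abelian.image.ι (i ≫ S.g) = i ≫ S.g := Abelian.image.fac _
    have hκ : κ ≫ e = 0 := by
      rw [← cancel_mono (Abelian.image.ι (i ≫ S.g)), Category.assoc, he, kernel.condition,
        zero_comp]
    have hex : (ShortComplex.mk κ e hκ).Exact := by
      refine ShortComplex.exact_of_f_is_kernel _ (KernelFork.IsLimit.ofι' _ _ (fun {Z} k hk => ?_))
      exact ⟨kernel.lift _ k (by rw [← he]; erw [reassoc_of% hk]; simp), kernel.lift_ι _ _ _⟩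
    have : Epi (ShortComplex.mk κ e hκ).g := inferInstanceAs (Epi e)
    have hp : e ≫ hex.desc p h0 = p := hex.g_desc p h0
    have : Epi (e ≫ hex.desc p h0) := by rw [hp]; infer_instance
    exact ⟨_, Abelian.image.ι (i ≫ S.g), hex.desc p h0, inferInstance, epi_of_epi e _⟩
  · left
    have : Epi (κ ≫ p) := epi_of_nonzero_to_simple h0
    have hl : (κ ≫ i) ≫ S.g = 0 := by rw [Category.assoc, kernel.condition]
    have hf : hS.exact.lift (κ ≫ i) hl ≫ S.f = κ ≫ i := hS.exact.lift_f _ _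
    have : Mono (hS.exact.lift (κ ≫ i) hl ≫ S.f) := by rw [hf]; infer_instance
    exact ⟨_, hS.exact.lift (κ ≫ i) hl, κ ≫ p, mono_of_mono _ S.f, inferInstance⟩

/-- The objects all of whose simple subquotients satisfy `Q`. -/
def simpleSubquotientsIn (Q : ObjectProperty C) : ObjectProperty C := fun X =>
  ∀ T : C, Simple T → IsSubquotient T X → Q T

instance (Q : ObjectProperty C) : (simpleSubquotientsIn Q).IsSerreClass where
  exists_zero := ⟨0, isZero_zero C, fun T _ ⟨_, i, p, _, _⟩ =>
    (Simple.not_isZero T ((IsZero.of_mono i (isZero_zero C)).of_epi p)).elim⟩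
  prop_of_mono f _ h T hT hX := h T hT (hX.of_mono f)
  prop_of_epi f _ h T hT hX := h T hT (hX.of_epi f)
  prop_X₂_of_shortExact hS h₁ h₃ T hT hX :=
    (hX.of_shortExact hS).elim (h₁ T hT) (h₃ T hT)

/-- Dévissage: a property of objects which is stable under extensions holds for `X` if it holds
for the simple subquotients of `X`. -/
lemma prop_of_simpleSubquotientsIn (hA : ∀ X : C, IsArtinianObject X) {P : ObjectProperty C}
    [P.IsClosedUnderIsomorphisms] (h0 : ∀ X, IsZero X → P X)
    (hext : ∀ S : ShortComplex C, S.ShortExact → P S.X₁ → P S.X₃ → P S.X₂)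
    {X : C} [IsNoetherianObject X] (hX : simpleSubquotientsIn P X) : P X := by
  have hbot : P ((⊥ : Subobject X) : C) :=
    h0 _ (IsZero.of_iso (isZero_zero C) Subobject.botCoeIsoZero)
  obtain ⟨A, hA', hmax⟩ := wellFounded_gt.has_min {A : Subobject X | P (A : C)} ⟨⊥, hbot⟩
  by_cases htop : A = ⊤
  · subst htop
    exact P.prop_of_iso (asIso (⊤ : Subobject X).arrow) hA'
  exfalso
  have hnz : ¬ IsZero (cokernel A.arrow) := fun h => htop (by
    have : Epi A.arrow := Abelian.epi_of_cokernel_π_eq_zero _ (h.eq_of_tgt _ _)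
    have := isIso_of_mono_of_epi A.arrow
    exact Subobject.eq_top_of_isIso_arrow A)
  have := hA (cokernel A.arrow)
  obtain ⟨Y, hY⟩ := exists_simple_subobject hnz
  obtain ⟨B, i, p, g, w, hB, hpb, hi, hg, -⟩ :=
    exists_pullback_shortExact (shortExact_cokernel A.arrow) Y.arrow
  have : Mono g := hg inferInstance
  have : Epi p := hB.epi_g
  have hPB : P B := hext _ hB hA' (hX _ hY ⟨B, g, p, inferInstance, inferInstance⟩)
  have hle : A ≤ Subobject.mk g := Subobject.le_mk_of_comm i hi
  refine hmax (Subobject.mk g) (P.prop_of_iso (Subobject.underlyingIso g).symm hPB)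
    (lt_of_le_of_ne hle fun heq => Simple.not_isZero (Y : C) ?_)
  have hz : p = 0 := by
    rw [← cancel_mono Y.arrow, ← hpb.w, zero_comp]
    have : g = Subobject.ofMkLE g A heq.ge ≫ A.arrow := (Subobject.ofMkLE_arrow _).symm
    dsimp
    rw [this, Category.assoc, cokernel.condition, comp_zero]
  exact (IsZero.iff_id_eq_zero _).2 (by rw [← cancel_epi p, hz]; simp)

end Devissage

section SerreGenerated

variable {C : Type u} [Category.{v} C] [Abelian C]

instance (S : ObjectProperty C) : (serreGenerated S).IsSerreClass where
  exists_zero := ⟨0, isZero_zero C, fun P _ _ => P.prop_of_isZero (isZero_zero C)⟩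
  prop_of_mono f _ h P hP hS := P.prop_of_mono f (h P hP hS)
  prop_of_epi f _ h P hP hS := P.prop_of_epi f (h P hP hS)
  prop_X₂_of_shortExact h h₁ h₃ P hP hS := P.prop_X₂_of_shortExact h (h₁ P hP hS) (h₃ P hP hS)

/-- The simple subquotients of an object of a Serre subcategory generated by simple objects
are among the generators. -/
lemma simpleSubquotientsIn_of_serreGenerated {S : ObjectProperty C}
    [S.IsClosedUnderIsomorphisms] (hS : ∀ X, S X → Simple X) {X : C} (hX : serreGenerated S X) :
    simpleSubquotientsIn S X := by
  refine hX (simpleSubquotientsIn S) inferInstance fun Y hY T hT ⟨A, i, p, _, _⟩ => ?_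
  have := hS Y hY
  have hp : p ≠ 0 := fun h => Simple.not_isZero T
    ((IsZero.iff_id_eq_zero _).2 (by rw [← cancel_epi p, h]; simp))
  have hi : i ≠ 0 := fun h => hp ((IsZero.of_mono_eq_zero i h).eq_of_src _ _)
  have := isIso_of_mono_of_nonzero hi
  have : Simple A := Simple.of_iso (asIso i)
  have := isIso_of_epi_of_nonzero hp
  exact S.prop_of_iso ((asIso i).symm ≪≫ asIso p) hY

end SerreGenerated

/-! ### Weights of composition factors of standard and costandard objects -/

namespace HighestWeightCategory

variable {k : Type*} [Field k] {C : Type u} [Category.{v} C] [Abelian C] [Linear k C]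
  [HasExt.{w} C] {Λ : Type*} [PartialOrder Λ] (H : HighestWeightCategory k C Λ)

/-- The objects isomorphic to a simple object whose weight belongs to `W`. -/
def simples (W : Set Λ) : ObjectProperty C := fun X => ∃ m ∈ W, Nonempty (X ≅ H.L m)

instance (W : Set Λ) : (H.simples W).IsClosedUnderIsomorphisms where
  of_iso e := fun ⟨m, hm, ⟨e'⟩⟩ => ⟨m, hm, ⟨e.symm ≪≫ e'⟩⟩

lemma simple_of_simples {W : Set Λ} {X : C} (h : H.simples W X) : Simple X := by
  obtain ⟨m, _, ⟨e⟩⟩ := h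
  have := H.simple_L m
  exact Simple.of_iso e

lemma wellFoundedLT (H : HighestWeightCategory k C Λ) : WellFoundedLT Λ :=
  StrictMono.wellFoundedLT (f := fun l => (Set.Iic l).ncard) fun _ b h =>
    Set.ncard_lt_ncard (Set.Iic_ssubset_Iic.2 h) (H.lowerFinite b)

/-- The objects all of whose composition factors have a weight in `W`. -/
abbrev weightsIn (W : Set Λ) : ObjectProperty C := simpleSubquotientsIn (H.simples W)

lemma weightsIn_univ (X : C) : H.weightsIn Set.univ X := fun T hT _ => by
  obtain ⟨l, hl⟩ := H.exists_iso_L T hT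
  exact ⟨l, trivial, hl⟩

/-- Dévissage along the weights. -/
lemma prop_of_weightsIn {P : ObjectProperty C} [P.IsClosedUnderIsomorphisms]
    (h0 : ∀ X, IsZero X → P X)
    (hext : ∀ S : ShortComplex C, S.ShortExact → P S.X₁ → P S.X₃ → P S.X₂)
    {W : Set Λ} (hL : ∀ m ∈ W, P (H.L m)) {X : C} (hX : H.weightsIn W X) : P X := by
  have := (H.finiteLength X).2
  refine prop_of_simpleSubquotientsIn (fun X => (H.finiteLength X).1) h0 hext fun T hT hTX => ?_
  obtain ⟨m, hm, ⟨e⟩⟩ := hX T hT hTX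
  exact P.prop_of_iso e.symm (hL m hm)

lemma π_comp_ι_ne_zero (l : Λ) : H.π l ≫ H.ι l ≠ 0 := fun h => by
  have := (H.projectiveCover l).epi
  have := (H.injectiveHull l).mono
  have := H.simple_L l
  exact Simple.not_isZero (H.L l) ((IsZero.iff_id_eq_zero _).2 (by
    rw [← cancel_epi (H.π l), ← cancel_mono (H.ι l)]; simpa using h))

/-- The Hom space is a line and `H.π l ≫ H.ι l` is non-zero in it. This is what forces `L l` to
occur only once in `Δ l` and in `nabla l`. -/
lemma exists_smul_eq (l : Λ) (f : H.Δ l ⟶ H.nabla l) : ∃ c : k, f = c • (H.π l ≫ H.ι l) := by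
  obtain ⟨e⟩ := H.hom_Δ_nabla l
  have h : e (H.π l ≫ H.ι l) ≠ 0 := by simpa using H.π_comp_ι_ne_zero l
  exact ⟨e f / e (H.π l ≫ H.ι l), e.injective (by simp [h])⟩

lemma weightsIn_of_serreGenerated {l : Λ} {X : C}
    (hX : serreGenerated (fun X => ∃ m ≤ l, Nonempty (X ≅ H.L m)) X) :
    H.weightsIn (Set.Iic l) X :=
  simpleSubquotientsIn_of_serreGenerated (S := H.simples (Set.Iic l))
    (fun _ h => H.simple_of_simples h) hX

lemma weightsIn_Iio_of_Iic {l : Λ} {X : C} (hX : H.weightsIn (Set.Iic l) X)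
    (h : ¬ IsSubquotient (H.L l) X) : H.weightsIn (Set.Iio l) X := fun T hT ⟨A, i, p, hi, hp⟩ => by
  obtain ⟨m, hm, ⟨e⟩⟩ := hX T hT ⟨A, i, p, hi, hp⟩
  refine ⟨m, lt_of_le_of_ne hm ?_, ⟨e⟩⟩
  rintro rfl
  exact h ⟨A, i, p ≫ e.hom, hi, inferInstance⟩

/-- The composition factors of the radical of a standard object have strictly smaller weights. -/
lemma weightsIn_kernel_π (l : Λ) : H.weightsIn (Set.Iio l) (kernel (H.π l)) := by
  have hΔ := (H.projectiveCover l).mem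
  refine H.weightsIn_Iio_of_Iic (H.weightsIn_of_serreGenerated
    (ObjectProperty.prop_of_mono _ (kernel.ι (H.π l)) hΔ)) ?_
  rintro ⟨A, i, p, _, _⟩
  have hA := ObjectProperty.prop_of_mono _ (i ≫ kernel.ι (H.π l)) hΔ
  have hL := ObjectProperty.prop_of_epi _ p hA
  -- A copy of `L l` inside the radical would be reached by `g` and detected by `g'`, making the
  -- composite `π ≫ ι`. But `g'` is a multiple of `π ≫ ι`, so it kills the radical.
  obtain ⟨g, hg⟩ := (H.projectiveCover l).lift p (H.π l) hA hL inferInstance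
  obtain ⟨g', hg'⟩ := (H.injectiveHull l).extend (i ≫ kernel.ι (H.π l)) (p ≫ H.ι l) hA hΔ
    inferInstance
  obtain ⟨c, rfl⟩ := H.exists_smul_eq l g'
  apply H.π_comp_ι_ne_zero l
  rw [← hg, Category.assoc, ← hg']
  simp

/-- The composition factors of the cosocle part of a costandard object have strictly smaller
weights. -/
lemma weightsIn_cokernel_ι (l : Λ) : H.weightsIn (Set.Iio l) (cokernel (H.ι l)) := by
  have hN := (H.injectiveHull l).mem
  have := (H.injectiveHull l).mono
  refine H.weightsIn_Iio_of_Iic (H.weightsIn_of_serreGenerated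
    (ObjectProperty.prop_of_epi _ (cokernel.π (H.ι l)) hN)) ?_
  rintro ⟨A, i, p, _, _⟩
  obtain ⟨B, j, q, m, w, hB, hpb, hj, hm, -⟩ :=
    exists_pullback_shortExact (shortExact_cokernel (H.ι l)) i
  have : Mono m := hm inferInstance
  have : Epi q := hB.epi_g
  dsimp at j w hB hj
  have hB' := ObjectProperty.prop_of_mono _ m hN
  have hL := ObjectProperty.prop_of_epi _ (q ≫ p) hB'
  obtain ⟨g, hg⟩ := (H.projectiveCover l).lift (q ≫ p) (H.π l) hB' hL inferInstance
  obtain ⟨g', hg'⟩ := (H.injectiveHull l).extend m ((q ≫ p) ≫ H.ι l) hB' hN inferInstance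
  -- Dually, `g ≫ m` is a multiple of `π ≫ ι`, so it factors through `ι = j ≫ m`; and `m ≫ g'`
  -- factors through `q`, which kills `j`.
  obtain ⟨c, hc⟩ := H.exists_smul_eq l (g ≫ m)
  apply H.π_comp_ι_ne_zero l
  calc H.π l ≫ H.ι l = (g ≫ m) ≫ g' := by rw [Category.assoc, hg', ← Category.assoc, hg]
    _ = 0 := by
      rw [hc, Linear.smul_comp, Category.assoc, ← hj, Category.assoc, hg', Category.assoc,
        reassoc_of% w]
      simp

end HighestWeightCategory

/-! ### Approximations by acyclic objects and vanishing of all higher extensions -/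

namespace HighestWeightCategory

variable {k : Type*} [Field k] {C : Type u} [Category.{v} C] [Abelian C] [Linear k C]
  [HasExt.{w} C] {Λ : Type*} [PartialOrder Λ] (H : HighestWeightCategory k C Λ)

/-- The objects `N` with `Ext¹(Δ l, N) = Ext²(Δ l, N) = 0` for all weights `l`. -/
def nablaAcyclic : ObjectProperty C := fun N =>
  ∀ l, ExtVanish 1 (H.Δ l) N ∧ ExtVanish 2 (H.Δ l) N

/-- The objects `D` with `Ext¹(D, N) = Ext²(D, N) = 0` for all `N` in `H.nablaAcyclic`. -/
def deltaAcyclic : ObjectProperty C := fun D =>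
  ∀ N, H.nablaAcyclic N → ExtVanish 1 D N ∧ ExtVanish 2 D N

lemma nablaAcyclic_nabla (l : Λ) : H.nablaAcyclic (H.nabla l) := fun m =>
  ⟨extVanish_iff_subsingleton.2 (H.ext_one m l), extVanish_iff_subsingleton.2 (H.ext_two m l)⟩

lemma deltaAcyclic_Δ (l : Λ) : H.deltaAcyclic (H.Δ l) := fun _ hN => hN l

instance : H.nablaAcyclic.IsClosedUnderIsomorphisms where
  of_iso e h l := ⟨(h l).1.of_iso_right e.symm, (h l).2.of_iso_right e.symm⟩

instance : H.deltaAcyclic.IsClosedUnderIsomorphisms where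
  of_iso e h N hN := ⟨(h N hN).1.of_iso_left e.symm, (h N hN).2.of_iso_left e.symm⟩

instance : H.nablaAcyclic.IsClosedUnderExtensions where
  prop_X₂_of_shortExact hS h₁ h₃ l :=
    ⟨.cov_mid hS (h₁ l).1 (h₃ l).1, .cov_mid hS (h₁ l).2 (h₃ l).2⟩

instance : H.deltaAcyclic.IsClosedUnderExtensions where
  prop_X₂_of_shortExact hS h₁ h₃ N hN :=
    ⟨.contra_mid hS (h₁ N hN).1 (h₃ N hN).1, .contra_mid hS (h₁ N hN).2 (h₃ N hN).2⟩

lemma nablaAcyclic_of_isZero {X : C} (hX : IsZero X) : H.nablaAcyclic X := fun _ =>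
  ⟨extVanish_of_isZero_right hX, extVanish_of_isZero_right hX⟩

lemma deltaAcyclic_of_isZero {X : C} (hX : IsZero X) : H.deltaAcyclic X := fun _ _ =>
  ⟨extVanish_of_isZero_left hX, extVanish_of_isZero_left hX⟩

/-- `X` is a quotient of an object of `H.deltaAcyclic` with kernel in `H.nablaAcyclic`. -/
def HasDeltaApproximation : ObjectProperty C := fun X =>
  ∃ (D : C) (p : D ⟶ X), Epi p ∧ H.deltaAcyclic D ∧ H.nablaAcyclic (kernel p)

/-- `X` is a subobject of an object of `H.nablaAcyclic` with cokernel in `H.deltaAcyclic`. -/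
def HasNablaApproximation : ObjectProperty C := fun X =>
  ∃ (N : C) (i : X ⟶ N), Mono i ∧ H.nablaAcyclic N ∧ H.deltaAcyclic (cokernel i)

instance : H.HasDeltaApproximation.IsClosedUnderIsomorphisms where
  of_iso e := fun ⟨D, p, _, hD, hK⟩ => ⟨D, p ≫ e.hom, inferInstance, hD,
    H.nablaAcyclic.prop_of_iso (kernelCompMono p e.hom).symm hK⟩

instance : H.HasNablaApproximation.IsClosedUnderIsomorphisms where
  of_iso e := fun ⟨N, i, _, hN, hQ⟩ => ⟨N, e.inv ≫ i, inferInstance, hN,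
    H.deltaAcyclic.prop_of_iso (cokernelEpiComp e.inv i).symm hQ⟩

lemma hasDeltaApproximation_of_isZero {X : C} (hX : IsZero X) : H.HasDeltaApproximation X :=
  ⟨X, 𝟙 X, inferInstance, H.deltaAcyclic_of_isZero hX,
    H.nablaAcyclic_of_isZero (hX.of_mono (kernel.ι _))⟩

lemma hasNablaApproximation_of_isZero {X : C} (hX : IsZero X) : H.HasNablaApproximation X :=
  ⟨X, 𝟙 X, inferInstance, H.nablaAcyclic_of_isZero hX,
    H.deltaAcyclic_of_isZero (hX.of_epi (cokernel.π _))⟩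

/-- A horseshoe argument: the extension, pulled back to `D₃`, lifts to an extension of `D₃` by `D₁`,
the obstruction lying in `Ext^2(D₃, kernel p₁) = 0`. This is where acyclicity in degree 2 is needed.
-/
lemma hasDeltaApproximation_of_shortExact {S : ShortComplex C} (hS : S.ShortExact)
    (h₁ : H.HasDeltaApproximation S.X₁) (h₃ : H.HasDeltaApproximation S.X₃) :
    H.HasDeltaApproximation S.X₂ := by
  obtain ⟨D₁, p₁, _, hD₁, hK₁⟩ := h₁
  obtain ⟨D₃, p₃, _, hD₃, hK₃⟩ := h₃
  obtain ⟨E, i, q, w, hE, φ, rfl, rfl⟩ := exists_lift_extension hS p₁ p₃ (hD₃ _ hK₁).2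
  obtain ⟨K, hK, ⟨e₁⟩, ⟨e₂⟩, ⟨e₃⟩⟩ := exists_shortExact_kernels hE hS φ
  have := hE.epi_g
  have := hS.epi_g
  exact ⟨E, φ.τ₂, ShortComplex.epi_τ₂_of_exact_of_epi φ hS.exact,
    H.deltaAcyclic.prop_X₂_of_shortExact hE hD₁ hD₃,
    H.nablaAcyclic.prop_of_iso e₂ (H.nablaAcyclic.prop_X₂_of_shortExact hK
      (H.nablaAcyclic.prop_of_iso e₁.symm hK₁) (H.nablaAcyclic.prop_of_iso e₃.symm hK₃))⟩

lemma hasNablaApproximation_of_shortExact {S : ShortComplex C} (hS : S.ShortExact)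
    (h₁ : H.HasNablaApproximation S.X₁) (h₃ : H.HasNablaApproximation S.X₃) :
    H.HasNablaApproximation S.X₂ := by
  obtain ⟨N₁, i₁, _, hN₁, hQ₁⟩ := h₁
  obtain ⟨N₃, i₃, _, hN₃, hQ₃⟩ := h₃
  obtain ⟨E, i, q, w, hE, φ, rfl, rfl⟩ := exists_extend_extension hS i₁ i₃ (hQ₃ _ hN₁).2
  obtain ⟨K, hK, ⟨e₁⟩, ⟨e₂⟩, ⟨e₃⟩⟩ := exists_shortExact_cokernels hS hE φ
  have := hE.mono_f
  have := hS.mono_f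
  exact ⟨E, φ.τ₂, ShortComplex.mono_τ₂_of_exact_of_mono φ hS.exact,
    H.nablaAcyclic.prop_X₂_of_shortExact hE hN₁ hN₃,
    H.deltaAcyclic.prop_of_iso e₂ (H.deltaAcyclic.prop_X₂_of_shortExact hK
      (H.deltaAcyclic.prop_of_iso e₁.symm hQ₁) (H.deltaAcyclic.prop_of_iso e₃.symm hQ₃))⟩

/-- Approximations of the cokernel of `L l ⟶ nabla l` yield approximations of `L l`. -/
lemma hasNablaApproximation_L {l : Λ} (h : H.HasDeltaApproximation (cokernel (H.ι l))) :
    H.HasNablaApproximation (H.L l) := by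
  have := (H.injectiveHull l).mono
  obtain ⟨D, p, _, hD, hK⟩ := h
  -- The pullback `P` is an extension of `nabla l` by the kernel of `p`, hence `nablaAcyclic`, and
  -- also an extension of `D` by `L l`.
  obtain ⟨P, i, q, g, w, hP, hpb, -, -, hg⟩ :=
    exists_pullback_shortExact (shortExact_cokernel (H.ι l)) p
  have : Epi g := hg inferInstance
  have := isIso_kernel_map_of_isPullback hpb
  exact ⟨P, i, hP.mono_f,
    H.nablaAcyclic.prop_X₂_of_shortExact (shortExact_kernel g)
      (H.nablaAcyclic.prop_of_iso (asIso (kernel.map _ _ _ _ hpb.w)).symm hK)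
      (H.nablaAcyclic_nabla l),
    H.deltaAcyclic.prop_of_iso (hP.gIsCokernel.coconePointUniqueUpToIso
      (colimit.isColimit _)) hD⟩

/-- Approximations of the kernel of `Δ l ⟶ L l` yield approximations of `L l`. -/
lemma hasDeltaApproximation_L {l : Λ} (h : H.HasNablaApproximation (kernel (H.π l))) :
    H.HasDeltaApproximation (H.L l) := by
  have := (H.projectiveCover l).epi
  obtain ⟨N, i, _, hN, hQ⟩ := h
  obtain ⟨P, j, p, g, w, hP, hpo, -, hg⟩ :=
    exists_pushout_shortExact (shortExact_kernel (H.π l)) i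
  have : Mono g := hg inferInstance
  have := isIso_cokernel_map_of_isPushout hpo.flip
  exact ⟨P, p, hP.epi_g,
    H.deltaAcyclic.prop_X₂_of_shortExact (shortExact_cokernel g) (H.deltaAcyclic_Δ l)
      (H.deltaAcyclic.prop_of_iso (asIso (cokernel.map _ _ _ _ hpo.flip.w)) hQ),
    H.nablaAcyclic.prop_of_iso (hP.fIsKernel.conePointUniqueUpToIso (limit.isLimit _)) hN⟩

/-- The two kinds must be treated together: each kind for `L l` uses the other kind for the smaller
weights in the kernel of `π` or the cokernel of `ι`. -/
lemma hasApproximations_L (l : Λ) :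
    H.HasDeltaApproximation (H.L l) ∧ H.HasNablaApproximation (H.L l) := by
  have := H.wellFoundedLT
  induction l using WellFoundedLT.induction with
  | ind l ih =>
    exact ⟨H.hasDeltaApproximation_L (H.prop_of_weightsIn
        (fun _ => H.hasNablaApproximation_of_isZero)
        (fun _ => H.hasNablaApproximation_of_shortExact) (fun m hm => (ih m hm).2)
        (H.weightsIn_kernel_π l)),
      H.hasNablaApproximation_L (H.prop_of_weightsIn
        (fun _ => H.hasDeltaApproximation_of_isZero)
        (fun _ => H.hasDeltaApproximation_of_shortExact) (fun m hm => (ih m hm).1)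
        (H.weightsIn_cokernel_ι l))⟩

lemma hasDeltaApproximation (X : C) : H.HasDeltaApproximation X :=
  H.prop_of_weightsIn (fun _ => H.hasDeltaApproximation_of_isZero)
    (fun _ => H.hasDeltaApproximation_of_shortExact) (fun m _ => (H.hasApproximations_L m).1)
    (H.weightsIn_univ X)

/-- The vanishing of `Ext¹` against `H.nablaAcyclic` suffices for membership in
`H.deltaAcyclic`. -/
lemma deltaAcyclic_of_extVanish_one {X : C} (h : ∀ N, H.nablaAcyclic N → ExtVanish 1 X N) :
    H.deltaAcyclic X := by
  obtain ⟨D, p, _, hD, hK⟩ := H.hasDeltaApproximation X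
  -- The approximation splits, so `X` is a direct summand of `D` and inherits the vanishing in
  -- degree 2.
  obtain ⟨s, hs⟩ := (h _ hK).exists_lift (shortExact_kernel p) (𝟙 X)
  exact fun N hN => ⟨h N hN, (hD N hN).2.of_retract_left s p hs⟩

/-- The higher extensions between `H.deltaAcyclic` and `H.nablaAcyclic` vanish. -/
lemma extVanish_of_acyclic {N : C} (hN : H.nablaAcyclic N) (n : ℕ) :
    ∀ X, H.deltaAcyclic X → ExtVanish (n + 1) X N := by
  induction n with
  | zero => exact fun X hX => (hX N hN).1
  | succ n ih =>
    intro X hX e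
    obtain ⟨Y, p, _, hp⟩ := exists_epi_comp_eq_zero e
    obtain ⟨D, q, _, hD, -⟩ := H.hasDeltaApproximation Y
    -- `Ext^1` of the kernel is squeezed between `Ext^1(D, N')` and `Ext^2(X, N')`.
    have hK : H.deltaAcyclic (kernel (q ≫ p)) := H.deltaAcyclic_of_extVanish_one fun N' hN' =>
      .contra_left (shortExact_kernel (q ≫ p)) (hD N' hN').1 (hX N' hN').2
    obtain ⟨a, rfl⟩ := Abelian.Ext.contravariant_sequence_exact₃ (shortExact_kernel (q ≫ p)) N e
      (by rw [← Abelian.Ext.mk₀_comp_mk₀_assoc, hp, Abelian.Ext.comp_zero]) (add_comm 1 (n + 1))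
    rw [ih _ hK a, Abelian.Ext.comp_zero]

lemma extVanish_Δ_nabla (l m : Λ) (n : ℕ) : ExtVanish (n + 1) (H.Δ l) (H.nabla m) :=
  H.extVanish_of_acyclic (H.nablaAcyclic_nabla m) n _ (H.deltaAcyclic_Δ l)

end HighestWeightCategory

/-! ### Filtrations by a family of objects -/

section Filtration

variable {C : Type u} [Category.{v} C] [Abelian C]

lemma prop_of_hasFiltrationBy {Λ : Type*} {S : Λ → C} {P : ObjectProperty C}
    [P.IsClosedUnderIsomorphisms] [P.IsClosedUnderExtensions] (h0 : ∀ X, IsZero X → P X)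
    (hS : ∀ l, P (S l)) {M : C} (hM : HasFiltrationBy S M) : P M := by
  obtain ⟨r, F, hF, hF0, hFr, hq⟩ := hM
  have key : ∀ i ≤ r, P (F i : C) := by
    intro i
    induction i with
    | zero =>
      intro _
      rw [hF0]
      exact h0 _ (IsZero.of_iso (isZero_zero C) Subobject.botCoeIsoZero)
    | succ i ih =>
      intro hi
      obtain ⟨l, ⟨e⟩⟩ := hq i hi
      exact P.prop_X₂_of_shortExact
        (shortExact_cokernel (Subobject.ofLE (F i) (F (i + 1)) (hF i.le_succ)))
        (ih (by lia)) (P.prop_of_iso e.symm (hS l))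
  have h := key r le_rfl
  rw [hFr] at h
  exact P.prop_of_iso (asIso (⊤ : Subobject M).arrow) h

/-- A filtration of a subobject can be prolonged by one step. -/
lemma exists_filtration_succ {Λ : Type*} {S : Λ → C} {M : C} {K' K : Subobject M} (hK : K' ≤ K)
    {l : Λ} (e : cokernel (Subobject.ofLE K' K hK) ≅ S l)
    (h : ∃ (r : ℕ) (F : ℕ → Subobject M) (hF : Monotone F), F 0 = ⊥ ∧ F r = K' ∧
      ∀ i < r, ∃ l : Λ,
        Nonempty (cokernel (Subobject.ofLE (F i) (F (i + 1)) (hF i.le_succ)) ≅ S l)) :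
    ∃ (r : ℕ) (F : ℕ → Subobject M) (hF : Monotone F), F 0 = ⊥ ∧ F r = K ∧
      ∀ i < r, ∃ l : Λ,
        Nonempty (cokernel (Subobject.ofLE (F i) (F (i + 1)) (hF i.le_succ)) ≅ S l) := by
  obtain ⟨r, F, hF, hF0, hFr, hq⟩ := h
  have congr : ∀ {A B A' B' : Subobject M} (hA : A' = A) (hB : B' = B) (h : A ≤ B)
      (h' : A' ≤ B') {X : C}, Nonempty (cokernel (Subobject.ofLE A B h) ≅ X) →
        Nonempty (cokernel (Subobject.ofLE A' B' h') ≅ X) := by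
    rintro A B _ _ rfl rfl h h' X e
    exact e
  let G : ℕ → Subobject M := fun i => if i ≤ r then F i else K
  have hG : ∀ {i}, i ≤ r → G i = F i := fun h => if_pos h
  have hG' : ∀ {i}, ¬ i ≤ r → G i = K := fun h => if_neg h
  refine ⟨r + 1, G, fun i j hij => ?_, (hG (zero_le)).trans hF0, hG' (by lia), fun i hi => ?_⟩
  · by_cases hj : j ≤ r
    · rw [hG hj, hG (hij.trans hj)]
      exact hF hij
    · rw [hG' hj]
      by_cases hi : i ≤ r
      · rw [hG hi]
        exact (hF hi).trans (hFr.le.trans hK)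
      · rw [hG' hi]
  · by_cases h : i < r
    · obtain ⟨l, e⟩ := hq i h
      exact ⟨l, congr (hG h.le) (hG h) _ _ e⟩
    · obtain rfl : i = r := by lia
      exact ⟨l, congr ((hG le_rfl).trans hFr) (hG' (by lia)) hK _ ⟨e⟩⟩

end Filtration

/-! ### The `Ext^1` criterion for `Δ`-filtrations -/

namespace HighestWeightCategory

variable {k : Type*} [Field k] {C : Type u} [Category.{v} C] [Abelian C] [Linear k C]
  [HasExt.{w} C] {Λ : Type*} [PartialOrder Λ] (H : HighestWeightCategory k C Λ)

lemma deltaAcyclic_of_hasDeltaFiltration {M : C} (hM : H.HasDeltaFiltration M) :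
    H.deltaAcyclic M :=
  prop_of_hasFiltrationBy (fun _ => H.deltaAcyclic_of_isZero) H.deltaAcyclic_Δ hM

lemma nablaAcyclic_of_hasNablaFiltration {M : C} (hM : H.HasNablaFiltration M) :
    H.nablaAcyclic M :=
  prop_of_hasFiltrationBy (fun _ => H.nablaAcyclic_of_isZero) H.nablaAcyclic_nabla hM

/-- Dévissage for the vanishing of `Ext` in the second variable. -/
lemma extVanish_of_weightsIn {n : ℕ} {M : C} {W : Set Λ} (hL : ∀ m ∈ W, ExtVanish n M (H.L m))
    {X : C} (hX : H.weightsIn W X) : ExtVanish n M X := by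
  let P : ObjectProperty C := fun Y => ExtVanish n M Y
  have : P.IsClosedUnderIsomorphisms := ⟨fun e h => h.of_iso_right e.symm⟩
  exact H.prop_of_weightsIn (P := P) (fun _ => extVanish_of_isZero_right)
    (fun _ hS h₁ h₃ => .cov_mid hS h₁ h₃) hL hX

/-- Dévissage for the vanishing of `Ext` in the first variable. -/
lemma extVanish_of_weightsIn_left {n : ℕ} {N : C} {W : Set Λ}
    (hL : ∀ m ∈ W, ExtVanish n (H.L m) N) {X : C} (hX : H.weightsIn W X) : ExtVanish n X N := by
  let P : ObjectProperty C := fun Y => ExtVanish n Y N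
  have : P.IsClosedUnderIsomorphisms := ⟨fun e h => h.of_iso_left e.symm⟩
  exact H.prop_of_weightsIn (P := P) (fun _ => extVanish_of_isZero_left)
    (fun _ hS h₁ h₃ => .contra_mid hS h₁ h₃) hL hX

lemma exists_not_extVanish_zero_L {M : C} (hM : ¬ IsZero M) : ∃ l, ¬ ExtVanish 0 M (H.L l) := by
  by_contra! h
  exact hM ((IsZero.iff_id_eq_zero _).2 (extVanish_zero_iff.1
    (H.extVanish_of_weightsIn (fun m _ => h m) (H.weightsIn_univ M)) (𝟙 M)))

lemma exists_not_extVanish_L_zero {M : C} (hM : ¬ IsZero M) : ∃ l, ¬ ExtVanish 0 (H.L l) M := by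
  by_contra! h
  exact hM ((IsZero.iff_id_eq_zero _).2 (extVanish_zero_iff.1
    (H.extVanish_of_weightsIn_left (fun m _ => h m) (H.weightsIn_univ M)) (𝟙 M)))

lemma not_isZero_Δ (l : Λ) : ¬ IsZero (H.Δ l) := fun h => by
  have := (H.projectiveCover l).epi
  have := H.simple_L l
  exact Simple.not_isZero (H.L l) (h.of_epi (H.π l))

lemma eq_zero_of_extVanish_Δ_zero {M : C} (h : ∀ l, ExtVanish 0 (H.Δ l) M) : IsZero M := by
  by_contra hM
  obtain ⟨l, hl⟩ := H.exists_not_extVanish_L_zero hM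
  refine hl (extVanish_zero_iff.2 fun f => ?_)
  have := (H.projectiveCover l).epi
  rw [← cancel_epi (H.π l), extVanish_zero_iff.1 (h l) (H.π l ≫ f), comp_zero]

lemma eq_zero_of_extVanish_nabla_zero {M : C} (h : ∀ l, ExtVanish 0 M (H.nabla l)) :
    IsZero M := by
  by_contra hM
  obtain ⟨l, hl⟩ := H.exists_not_extVanish_zero_L hM
  refine hl (extVanish_zero_iff.2 fun f => ?_)
  have := (H.injectiveHull l).mono
  rw [← cancel_mono (H.ι l), extVanish_zero_iff.1 (h l) (f ≫ H.ι l), zero_comp]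

/-- A non-zero object without extensions by costandard objects has a standard quotient. -/
lemma exists_epi_Δ {M : C} (hM : ¬ IsZero M) (h : ∀ l, ExtVanish 1 M (H.nabla l)) :
    ∃ (l : Λ) (p : M ⟶ H.Δ l), Epi p := by
  have := H.wellFoundedLT
  -- Minimality of `l` gives `Ext^1(M, L m) = 0` for `m ≤ l`, because `nabla m / L m` has only
  -- weights below `l`, where Hom from `M` vanishes. A non-zero map to `L l` then lifts to `Δ l`,
  -- and it is epi as `π` is essential.
  obtain ⟨l, hl, hmin⟩ := wellFounded_lt.has_min {l | ¬ ExtVanish 0 M (H.L l)}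
    (H.exists_not_extVanish_zero_L hM)
  have hlt : ∀ m < l, ExtVanish 0 M (H.L m) := fun m hm => by
    by_contra hm'
    exact hmin m hm' hm
  have h₁ : ∀ m ≤ l, ExtVanish 1 M (H.L m) := fun m hm => by
    have := (H.injectiveHull m).mono
    exact .cov_left (shortExact_cokernel (H.ι m)) (H.extVanish_of_weightsIn
      (fun m' hm' => hlt m' (lt_of_lt_of_le hm' hm)) (H.weightsIn_cokernel_ι m)) (h m)
  obtain ⟨f, hf⟩ : ∃ f : M ⟶ H.L l, f ≠ 0 := by
    by_contra! h'
    exact hl (extVanish_zero_iff.2 h')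
  have := H.simple_L l
  have : Epi f := epi_of_nonzero_to_simple hf
  have := (H.projectiveCover l).epi
  obtain ⟨p, hp⟩ := (H.extVanish_of_weightsIn (fun m hm => h₁ m (le_of_lt hm))
    (H.weightsIn_kernel_π l)).exists_lift (shortExact_kernel (H.π l)) f
  dsimp at p hp
  refine ⟨l, p, ?_⟩
  have hi : Abelian.factorThruImage p ≫ Abelian.image.ι p = p := Abelian.image.fac p
  have : Epi (Abelian.factorThruImage p ≫ Abelian.image.ι p ≫ H.π l) := by
    rw [← Category.assoc, hi, hp]
    infer_instance
  have := (H.projectiveCover l).essential (Abelian.image.ι p)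
    (ObjectProperty.prop_of_mono _ (Abelian.image.ι p) (H.projectiveCover l).mem)
    (epi_of_epi (Abelian.factorThruImage p) _)
  rw [← hi]
  infer_instance

/-- An object without extensions by costandard objects has a `Δ`-filtration. -/
lemma hasDeltaFiltration_of_extVanish {M : C} (hM : ∀ l, ExtVanish 1 M (H.nabla l)) :
    H.HasDeltaFiltration M := by
  have := (H.finiteLength M).1
  suffices key : ∀ K : Subobject M, (∀ l, ExtVanish 1 (K : C) (H.nabla l)) →
      ∃ (r : ℕ) (F : ℕ → Subobject M) (hF : Monotone F), F 0 = ⊥ ∧ F r = K ∧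
        ∀ i < r, ∃ l : Λ,
          Nonempty (cokernel (Subobject.ofLE (F i) (F (i + 1)) (hF i.le_succ)) ≅ H.Δ l) from
    key ⊤ fun l => (hM l).of_iso_left (asIso (⊤ : Subobject M).arrow)
  intro K
  induction K using WellFoundedLT.induction with
  | ind K ih =>
    intro hK
    by_cases hz : IsZero (K : C)
    · have hbot : ⊥ = K := by
        rw [← Subobject.mk_arrow K, eq_comm, Subobject.mk_eq_bot_iff_zero]
        exact hz.eq_of_src _ _
      exact ⟨0, fun _ => ⊥, monotone_const, rfl, hbot, fun i hi => by lia⟩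
    obtain ⟨l, p, _⟩ := H.exists_epi_Δ hz hK
    let j := kernel.ι p ≫ K.arrow
    have hle : Subobject.mk j ≤ K := Subobject.mk_le_of_comm (kernel.ι p) rfl
    have hj : (Subobject.underlyingIso j).hom ≫ kernel.ι p =
        Subobject.ofLE (Subobject.mk j) K hle := by
      rw [← cancel_mono K.arrow, Subobject.ofLE_arrow, Category.assoc]
      exact Subobject.underlyingIso_hom_comp_eq_mk j
    have e : cokernel (Subobject.ofLE (Subobject.mk j) K hle) ≅ H.Δ l :=
      cokernelIsoOfEq hj.symm ≪≫ cokernelEpiComp _ (kernel.ι p) ≪≫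
        ((shortExact_kernel p).gIsCokernel.coconePointUniqueUpToIso (colimit.isColimit _)).symm
    have hlt : Subobject.mk j < K := lt_of_le_of_ne hle fun heq => by
      have h0 : ∀ {A B : Subobject M} (_ : A = B) (h : A ≤ B),
          IsZero (cokernel (Subobject.ofLE A B h)) := by
        rintro A _ rfl h
        rw [Subobject.ofLE_refl]
        exact isZero_cokernel_of_epi _
      exact H.not_isZero_Δ l ((h0 heq hle).of_iso e.symm)
    -- The kernel of `M ⟶ Δ l` satisfies the hypothesis again since `Ext^2(Δ l, nabla m) = 0`.
    refine exists_filtration_succ hle e (ih _ hlt fun m => ?_)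
    exact (ExtVanish.contra_left (shortExact_kernel p) (hK m)
      (H.extVanish_Δ_nabla l m 1)).of_iso_left (Subobject.underlyingIso j)

end HighestWeightCategory

/-! ### Abstract dimension shifting -/

section Dimension

/-- Families of predicates indexed by degrees which behave like the vanishing of a cohomological
functor along the triples satisfying `E`. -/
structure VanishingSystem {α : Type*} (E : α → α → α → Prop) (P : ℕ → α → Prop) : Prop where
  mid : ∀ {A B D j}, E A B D → P j A → P j D → P j B
  right : ∀ {A B D j}, E A B D → P j B → P (j + 1) A → P j D
  left : ∀ {A B D j}, E A B D → P j D → P (j + 1) B → P (j + 1) A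

variable {α : Type*} {E : α → α → α → Prop} {P : ℕ → α → Prop} (V : VanishingSystem E P)
  {z t b h : ℤ → α} (ht : ∀ i j, P (j + 1) (t i)) (hh : ∀ i, i ≠ 0 → ∀ j, P j (h i))
  (e₁ : ∀ i, E (z i) (t i) (b i)) (e₂ : ∀ i, E (b i) (z (i + 1)) (h (i + 1)))

include V ht hh e₁ e₂

/-- In the model, `z`, `t`, `h` are cycles, terms and cohomology, and `b i` is the boundaries in
degree `i + 1`. In negative degrees the complex is exact, so acyclicity spreads rightwards from the
zero terms. -/
lemma VanishingSystem.of_neg {a : ℤ} (ha : ∀ i < a, ∀ j, P j (z i)) {i : ℤ} (hi : i < 0) (j : ℕ) :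
    P (j + 1) (z i) ∧ P (j + 1) (b i) := by
  have hb : ∀ i, (∀ j, P (j + 1) (z i)) → ∀ j, P (j + 1) (b i) := fun i h j =>
    V.right (e₁ i) (ht i j) (h (j + 1))
  have key : ∀ m : ℕ, ∀ i < 0, i < a + m → ∀ j, P (j + 1) (z i) := by
    intro m
    induction m with
    | zero => exact fun i _ hi j => ha i (by simpa using hi) _
    | succ m ih =>
      intro i hi him j
      obtain ⟨i', rfl⟩ : ∃ i', i = i' + 1 := ⟨i - 1, by lia⟩
      exact V.mid (e₂ i') (hb i' (ih i' (by lia) (by push_cast at him; lia)) j)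
        (hh _ (by lia) _)
  have hz := key (i - a + 1).toNat i hi (by lia)
  exact ⟨hz j, hb i hz j⟩

/-- Above degree 0 the complex is exact, so degree `j + 1` at `z i` reduces to degree `j` at `z (i +
1)`, until the index reaches `n`, where `b` vanishes. -/
lemma VanishingSystem.of_nonneg {n : ℤ} (hn : ∀ i, n < i → ∀ j, P j (z i))
    (hb : ∀ i, n ≤ i → ∀ j, P j (b i)) {i : ℤ} (hi : 0 ≤ i) (j : ℕ) (hij : n ≤ i + j) :
    P (j + 1) (z i) := by
  have key : ∀ m : ℕ, ∀ i, 0 ≤ i → n < i + m → ∀ j : ℕ, n ≤ i + j → P (j + 1) (z i) := by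
    intro m
    induction m with
    | zero => exact fun i _ hi j _ => hn i (by simpa using hi) _
    | succ m ih =>
      intro i hi him j hij
      refine V.left (e₁ i) ?_ (ht i j)
      by_cases hin : n ≤ i
      · exact hb i hin j
      · obtain ⟨j, rfl⟩ := Nat.exists_eq_succ_of_ne_zero (n := j) (by rintro rfl; lia)
        exact V.left (e₂ i) (hh _ (by lia) _)
          (ih (i + 1) (by lia) (by push_cast at him; lia) j (by push_cast at hij; lia))
  exact key (n - i + 1).toNat i hi (by lia) j hij

/-- The vanishing in degrees above the upper bound of the resolution. -/
lemma VanishingSystem.of_lt {a n : ℤ} (ha : ∀ i < a, ∀ j, P j (z i))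
    (hn : ∀ i, n < i → ∀ j, P j (z i)) (hb : ∀ i, n ≤ i → ∀ j, P j (b i)) (j : ℕ) (hj : n < j)
    (hj0 : 0 < j) : P j (h 0) := by
  obtain ⟨j, rfl⟩ := Nat.exists_eq_succ_of_ne_zero hj0.ne'
  exact V.right (e₂ (-1)) (V.of_nonneg ht hh e₁ e₂ hn hb le_rfl j (by push_cast at hj; lia))
    (V.of_neg ht hh e₁ e₂ ha (by lia) _).2

/-- The vanishing in the degree of the last term of the resolution. -/
lemma VanishingSystem.one_of_last {a n : ℤ} (ha : ∀ i < a, ∀ j, P j (z i))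
    (hP : 0 ≤ n → P (n.toNat + 1) (h 0)) : P 1 (z n) := by
  by_cases hn : n < 0
  · exact (V.of_neg ht hh e₁ e₂ ha hn 0).1
  obtain ⟨m, rfl⟩ := Int.eq_ofNat_of_zero_le (not_lt.1 hn)
  -- Index plus degree stays `m + 1` on the way from `h 0` to `z m`; the subtraction is never
  -- truncated.
  have key : ∀ i ≤ m, P (m - i + 1) (z i) := by
    intro i
    induction i with
    | zero => exact fun _ => V.mid (e₂ (-1)) (V.of_neg ht hh e₁ e₂ ha (by lia) _).2 (hP (by lia))
    | succ i ih =>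
      intro hi
      have h₁ := ih (by lia)
      rw [show m - i = m - (i + 1) + 1 by lia] at h₁
      have := V.mid (e₂ i) (V.right (e₁ i) (ht _ _) h₁) (hh _ (by lia) _)
      exact_mod_cast this
  simpa using key m le_rfl

end Dimension

/-! ### Cycles, opcycles and boundaries of a complex -/

section Complex

variable {C : Type u} [Category.{v} C] [Abelian C]

/-- There is a short exact sequence with the given terms. -/
def IsExtension (A B D : C) : Prop :=
  ∃ (f : A ⟶ B) (g : B ⟶ D) (w : f ≫ g = 0), (ShortComplex.mk f g w).ShortExact

lemma isExtension_of_isLimit {A B D : C} (f : A ⟶ B) (g : B ⟶ D) (w : f ≫ g = 0)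
    (h : IsLimit (KernelFork.ofι f w)) : IsExtension A B (Abelian.image g) := by
  have w' : f ≫ Abelian.factorThruImage g = 0 := by
    rw [← cancel_mono (Abelian.image.ι g), Category.assoc, Abelian.image.fac, w, zero_comp]
  have : Mono f := mono_of_isLimit_fork h
  have hex : (ShortComplex.mk _ _ w').Exact := ShortComplex.exact_of_f_is_kernel _
    (KernelFork.IsLimit.ofι' _ _ fun {Z} k hk => ⟨h.lift (KernelFork.ofι k (by
      rw [← Abelian.image.fac g]; erw [reassoc_of% hk]; simp)), h.fac _ .zero⟩)
  exact ⟨f, _, w', { exact := hex }⟩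

lemma isExtension_of_isColimit {A B D : C} (f : A ⟶ B) (g : B ⟶ D) (w : f ≫ g = 0)
    (h : IsColimit (CokernelCofork.ofπ g w)) : IsExtension (Abelian.image f) B D := by
  have w' : Abelian.image.ι f ≫ g = 0 := by
    rw [← cancel_epi (Abelian.factorThruImage f), ← Category.assoc, Abelian.image.fac, w,
      comp_zero]
  have : Epi g := epi_of_isColimit_cofork h
  have hex : (ShortComplex.mk _ _ w').Exact := ShortComplex.exact_of_g_is_cokernel _
    (CokernelCofork.IsColimit.ofπ' _ _ fun {Z} k hk => ⟨h.desc (CokernelCofork.ofπ k (by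
      rw [← Abelian.image.fac f, Category.assoc]; erw [hk]; simp)), h.fac _ .one⟩)
  exact ⟨_, g, w', { exact := hex }⟩

variable (T : CochainComplex C ℤ)

/-- The object of boundaries, as the image of `T.X i` in the cycles of degree `j`. -/
noncomputable abbrev boundariesIn (i j : ℤ) : C := Abelian.image (T.toCycles i j)

/-- The object of boundaries, as the image of the opcycles of degree `i` in `T.X j`. -/
noncomputable abbrev boundariesOut (i j : ℤ) : C := Abelian.image (T.fromOpcycles i j)

lemma isExtension_cycles {i j : ℤ} (hij : i + 1 = j) :
    IsExtension (T.cycles i) (T.X i) (boundariesIn T i j) := by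
  have w : T.iCycles i ≫ T.toCycles i j = 0 := by
    rw [← cancel_mono (T.iCycles j), Category.assoc, T.toCycles_i, T.iCycles_d, zero_comp]
  refine isExtension_of_isLimit _ _ w (KernelFork.IsLimit.ofι' _ _ fun {Z} k hk =>
    ⟨T.liftCycles k j (by simp [hij]) ?_, T.liftCycles_i _ _ _ _⟩)
  rw [← T.toCycles_i, ← Category.assoc, hk, zero_comp]

lemma isExtension_boundariesIn {i j : ℤ} (hij : i + 1 = j) :
    IsExtension (boundariesIn T i j) (T.cycles j) (T.homology j) :=
  isExtension_of_isColimit _ _ _ (T.homologyIsCokernel i j (by simp [← hij]))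

lemma isExtension_opcycles {i j : ℤ} (hij : i + 1 = j) :
    IsExtension (boundariesOut T i j) (T.X j) (T.opcycles j) := by
  have w : T.fromOpcycles i j ≫ T.pOpcycles j = 0 := by
    rw [← cancel_epi (T.pOpcycles i), T.p_fromOpcycles_assoc, T.d_pOpcycles, comp_zero]
  refine isExtension_of_isColimit _ _ w (CokernelCofork.IsColimit.ofπ' _ _ fun {Z} k hk =>
    ⟨T.descOpcycles k i (by simp [← hij]) ?_, T.p_descOpcycles _ _ _ _⟩)
  rw [← T.p_fromOpcycles, Category.assoc, hk, comp_zero]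

lemma isExtension_boundariesOut {i j : ℤ} (hij : i + 1 = j) :
    IsExtension (T.homology i) (T.opcycles i) (boundariesOut T i j) :=
  isExtension_of_isLimit _ _ _ (T.homologyIsKernel i j (by simp [hij]))

lemma isZero_boundariesIn {i j : ℤ} (h : IsZero (T.X j)) : IsZero (boundariesIn T i j) :=
  h.of_mono (Abelian.image.ι (T.toCycles i j) ≫ T.iCycles j)

lemma isZero_boundariesOut {i j : ℤ} (h : IsZero (T.X i)) : IsZero (boundariesOut T i j) :=
  h.of_epi (T.pOpcycles i ≫ Abelian.factorThruImage (T.fromOpcycles i j))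

lemma isZero_cycles {i : ℤ} (h : IsZero (T.X i)) : IsZero (T.cycles i) := h.of_mono (T.iCycles i)

lemma isZero_opcycles {i : ℤ} (h : IsZero (T.X i)) : IsZero (T.opcycles i) :=
  h.of_epi (T.pOpcycles i)

lemma isZero_homology {i : ℤ} (h : IsZero (T.X i)) : IsZero (T.homology i) :=
  (isZero_cycles T h).of_epi (T.homologyπ i)

/-- The last differential of a complex which is exact at its last term is an epimorphism with
kernel the cycles. -/
lemma shortExact_last {i j l : ℤ} (hij : i + 1 = j) (hjl : j + 1 = l) (hl : IsZero (T.X l))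
    (hj : IsZero (T.homology j)) :
    (ShortComplex.mk (T.iCycles i) (T.d i j) (T.iCycles_d i j)).ShortExact := by
  have he : (T.sc' i j l).Exact := by
    rw [← T.exactAt_iff' i j l (by simp [← hij]) (by simp [hjl]), T.exactAt_iff_isZero_homology]
    exact hj
  have : Epi (T.d i j) := he.epi_f (hl.eq_of_tgt _ _)
  exact { exact := ShortComplex.exact_of_f_is_kernel _ (T.cyclesIsKernel i j (by simp [hij])) }

/-- The first differential of a complex which is exact at its first term is a monomorphism with
cokernel the opcycles. -/
lemma shortExact_first {i j l : ℤ} (hij : i + 1 = j) (hli : l + 1 = i) (hl : IsZero (T.X l))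
    (hi : IsZero (T.homology i)) :
    (ShortComplex.mk (T.d i j) (T.pOpcycles j) (T.d_pOpcycles i j)).ShortExact := by
  have he : (T.sc' l i j).Exact := by
    rw [← T.exactAt_iff' l i j (by simp [← hli]) (by simp [hij]), T.exactAt_iff_isZero_homology]
    exact hi
  have : Mono (T.d i j) := he.mono_g (hl.eq_of_src _ _)
  have hex : (ShortComplex.mk _ _ (T.d_pOpcycles i j)).Exact :=
    ShortComplex.exact_of_g_is_cokernel _ (T.opcyclesIsCokernel i j (by simp [← hij]))
  exact { exact := hex }

lemma isZero_homology_of_iso_singleFunctor [HasDerivedCategory.{w'} C] {M : C}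
    (e : DerivedCategory.Q.obj T ≅ (DerivedCategory.singleFunctor C 0).obj M) {i : ℤ}
    (hi : i ≠ 0) : IsZero (T.homology i) := by
  have e' := ((DerivedCategory.homologyFunctorFactors C i).app T).symm ≪≫
    (DerivedCategory.homologyFunctor C i).mapIso e ≪≫
    (DerivedCategory.homologyFunctorFactors C i).app ((HomologicalComplex.single C _ 0).obj M)
  exact (HomologicalComplex.isZero_single_obj_homology _ _ _ _ hi).of_iso e'

lemma nonempty_homology_iso_of_iso_singleFunctor [HasDerivedCategory.{w'} C] {M : C}
    (e : DerivedCategory.Q.obj T ≅ (DerivedCategory.singleFunctor C 0).obj M) :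
    Nonempty (T.homology 0 ≅ M) :=
  ⟨((DerivedCategory.homologyFunctorFactors C 0).app T).symm ≪≫
    (DerivedCategory.homologyFunctor C 0).mapIso e ≪≫
    (DerivedCategory.homologyFunctorFactors C 0).app ((HomologicalComplex.single C _ 0).obj M) ≪≫
    HomologicalComplex.singleObjHomologySelfIso _ _ _⟩

end Complex

/-! ### Radical morphisms do not split -/

section Radical

variable {C : Type u} [Category.{v} C] [Abelian C]

lemma isZero_of_id_mem_jacobson {X : C} (h : (𝟙 X : End X) ∈ Ring.jacobson (End X)) :
    IsZero X := by
  by_contra hX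
  have : Nontrivial (End X) :=
    ⟨⟨𝟙 X, 0, fun h0 => hX ((IsZero.iff_id_eq_zero X).2 h0)⟩⟩
  have h1 : Ring.jacobson (End X) = ⊤ := (Ideal.eq_top_iff_one _).2 h
  rw [← Ideal.jacobson_bot, Ideal.jacobson_eq_top_iff] at h1
  exact bot_ne_top h1

/-- A morphism of the radical onto a non-zero object does not have a section. -/
lemma InRadical.isZero_of_section {P : ObjectProperty C} {A B : C} {f : A ⟶ B}
    (hf : InRadical P f) (hB : P B) (s : B ⟶ A) (hs : s ≫ f = 𝟙 B) : IsZero B :=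
  isZero_of_id_mem_jacobson (by simpa [hs] using hf hB s (𝟙 B))

/-- A morphism of the radical from a non-zero object does not have a retraction. -/
lemma InRadical.isZero_of_retraction {P : ObjectProperty C} {A B : C} {f : A ⟶ B}
    (hf : InRadical P f) (hA : P A) (r : B ⟶ A) (hr : f ≫ r = 𝟙 A) : IsZero A :=
  isZero_of_id_mem_jacobson (by simpa [hr] using hf hA (𝟙 A) r)

end Radical

/-! ### Minimal tilting complexes and filtration dimensions -/

namespace HighestWeightCategory

variable {k : Type*} [Field k] {C : Type u} [Category.{v} C] [Abelian C] [Linear k C]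
  [HasExt.{w} C] {Λ : Type*} [PartialOrder Λ] (H : HighestWeightCategory k C Λ)

lemma vanishingSystem_Δ : VanishingSystem (IsExtension (C := C))
    fun n X => ∀ l, ExtVanish n (H.Δ l) X where
  mid := fun ⟨_, _, _, h⟩ h₁ h₃ l => .cov_mid h (h₁ l) (h₃ l)
  right := fun ⟨_, _, _, h⟩ h₂ h₁ l => .cov_right h (h₂ l) (h₁ l)
  left := fun ⟨_, _, _, h⟩ h₃ h₂ l => .cov_left h (h₃ l) (h₂ l)

/-- Reversing the sequences makes the contravariant functors fit the same axioms; with degrees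
negated and opcycles for cycles, the `Δ`-dimension needs no separate argument. -/
lemma vanishingSystem_nabla : VanishingSystem (fun A B D : C => IsExtension D B A)
    fun n X => ∀ l, ExtVanish n X (H.nabla l) where
  mid := fun ⟨_, _, _, h⟩ h₃ h₁ l => .contra_mid h (h₁ l) (h₃ l)
  right := fun ⟨_, _, _, h⟩ h₂ h₃ l => .contra_left h (h₂ l) (h₃ l)
  left := fun ⟨_, _, _, h⟩ h₁ h₂ l => .contra_right h (h₁ l) (h₂ l)

lemma extVanish_of_hasDeltaFiltration {M N : C} (hM : H.HasDeltaFiltration M)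
    (h : ∀ l, ExtVanish 1 (H.Δ l) N) : ExtVanish 1 M N := by
  let P : ObjectProperty C := fun Y => ExtVanish 1 Y N
  have : P.IsClosedUnderIsomorphisms := ⟨fun e h => h.of_iso_left e.symm⟩
  have : P.IsClosedUnderExtensions := ⟨fun hS h₁ h₃ => .contra_mid hS h₁ h₃⟩
  exact prop_of_hasFiltrationBy (P := P) (fun _ => extVanish_of_isZero_left) h hM

lemma extVanish_of_hasNablaFiltration {M N : C} (hN : H.HasNablaFiltration N)
    (h : ∀ l, ExtVanish 1 M (H.nabla l)) : ExtVanish 1 M N := by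
  let P : ObjectProperty C := fun Y => ExtVanish 1 M Y
  have : P.IsClosedUnderIsomorphisms := ⟨fun e h => h.of_iso_right e.symm⟩
  have : P.IsClosedUnderExtensions := ⟨fun hS h₁ h₃ => .cov_mid hS h₁ h₃⟩
  exact prop_of_hasFiltrationBy (P := P) (fun _ => extVanish_of_isZero_right) h hN

lemma mem_nablaDegrees_iff {M : C} {d : ℕ} :
    d ∈ H.nablaDegrees M ↔ ¬ ∀ l, ExtVanish d (H.Δ l) M := by
  simp [nablaDegrees, not_extVanish_iff_nontrivial]

lemma mem_deltaDegrees_iff {M : C} {d : ℕ} :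
    d ∈ H.deltaDegrees M ↔ ¬ ∀ l, ExtVanish d M (H.nabla l) := by
  simp [deltaDegrees, not_extVanish_iff_nontrivial]

namespace IsMinimalTiltingComplex

variable [HasDerivedCategory.{w'} C] {H} {M : C} {T : CochainComplex C ℤ}
  (hT : H.IsMinimalTiltingComplex M T)

include hT

lemma isZero_homology {i : ℤ} (hi : i ≠ 0) : IsZero (T.homology i) :=
  isZero_homology_of_iso_singleFunctor T hT.iso.some hi

lemma nonempty_homology_iso : Nonempty (T.homology 0 ≅ M) :=
  nonempty_homology_iso_of_iso_singleFunctor T hT.iso.some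

lemma extVanish_Δ (i : ℤ) (j : ℕ) (l : Λ) : ExtVanish (j + 1) (H.Δ l) (T.X i) :=
  H.extVanish_of_acyclic (H.nablaAcyclic_of_hasNablaFiltration (hT.tilting i).2) j _
    (H.deltaAcyclic_Δ l)

lemma extVanish_nabla (i : ℤ) (j : ℕ) (l : Λ) : ExtVanish (j + 1) (T.X i) (H.nabla l) :=
  H.extVanish_of_acyclic (H.nablaAcyclic_nabla l) j _
    (H.deltaAcyclic_of_hasDeltaFiltration (hT.tilting i).1)

lemma extVanish_homology_Δ {n : ℤ} (hn : ∀ i, n < i → IsZero (T.X i)) {j : ℕ} (hj : n < j)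
    (hj0 : 0 < j) (l : Λ) : ExtVanish j (H.Δ l) (T.homology 0) := by
  obtain ⟨a, b, hab⟩ := hT.bounded
  exact H.vanishingSystem_Δ.of_lt (z := fun i => T.cycles i) (t := fun i => T.X i)
    (b := fun i => boundariesIn T i (i + 1)) (h := fun i => T.homology i)
    (fun i j l => hT.extVanish_Δ i j l)
    (fun i hi j l => extVanish_of_isZero_right (hT.isZero_homology hi))
    (fun i => isExtension_cycles T rfl) (fun i => isExtension_boundariesIn T rfl)
    (a := a) (n := n)
    (fun i hi j l => extVanish_of_isZero_right (isZero_cycles T (hab i (.inl hi))))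
    (fun i hi j l => extVanish_of_isZero_right (isZero_cycles T (hn i hi)))
    (fun i hi j l => extVanish_of_isZero_right (isZero_boundariesIn T (hn _ (by lia)))) j hj hj0 l

lemma extVanish_homology_nabla {n : ℤ} (hn : ∀ i, n < i → IsZero (T.X (-i))) {j : ℕ}
    (hj : n < j) (hj0 : 0 < j) (l : Λ) : ExtVanish j (T.homology 0) (H.nabla l) := by
  obtain ⟨a, b, hab⟩ := hT.bounded
  exact H.vanishingSystem_nabla.of_lt (z := fun i => T.opcycles (-i)) (t := fun i => T.X (-i))
    (b := fun i => boundariesOut T (-(i + 1)) (-i)) (h := fun i => T.homology (-i))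
    (fun i j l => hT.extVanish_nabla _ j l)
    (fun i hi j l => extVanish_of_isZero_left (hT.isZero_homology (by lia)))
    (fun i => isExtension_opcycles T (by lia)) (fun i => isExtension_boundariesOut T (by lia))
    (a := -b) (n := n)
    (fun i hi j l => extVanish_of_isZero_left (isZero_opcycles T (hab _ (.inr (by lia)))))
    (fun i hi j l => extVanish_of_isZero_left (isZero_opcycles T (hn i hi)))
    (fun i hi j l => extVanish_of_isZero_left (isZero_boundariesOut T (hn _ (by lia)))) j hj hj0 l

lemma extVanish_cycles {n : ℤ}
    (hP : 0 ≤ n → ∀ l, ExtVanish (n.toNat + 1) (H.Δ l) (T.homology 0)) (l : Λ) :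
    ExtVanish 1 (H.Δ l) (T.cycles n) := by
  obtain ⟨a, b, hab⟩ := hT.bounded
  exact H.vanishingSystem_Δ.one_of_last (z := fun i => T.cycles i) (t := fun i => T.X i)
    (b := fun i => boundariesIn T i (i + 1)) (h := fun i => T.homology i)
    (fun i j l => hT.extVanish_Δ i j l)
    (fun i hi j l => extVanish_of_isZero_right (hT.isZero_homology hi))
    (fun i => isExtension_cycles T rfl) (fun i => isExtension_boundariesIn T rfl)
    (a := a)
    (fun i hi j l => extVanish_of_isZero_right (isZero_cycles T (hab i (.inl hi)))) hP l

lemma extVanish_opcycles {n : ℤ}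
    (hP : 0 ≤ n → ∀ l, ExtVanish (n.toNat + 1) (T.homology 0) (H.nabla l)) (l : Λ) :
    ExtVanish 1 (T.opcycles (-n)) (H.nabla l) := by
  obtain ⟨a, b, hab⟩ := hT.bounded
  exact H.vanishingSystem_nabla.one_of_last (z := fun i => T.opcycles (-i))
    (t := fun i => T.X (-i))
    (b := fun i => boundariesOut T (-(i + 1)) (-i)) (h := fun i => T.homology (-i))
    (fun i j l => hT.extVanish_nabla _ j l)
    (fun i hi j l => extVanish_of_isZero_left (hT.isZero_homology (by lia)))
    (fun i => isExtension_opcycles T (by lia)) (fun i => isExtension_boundariesOut T (by lia))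
    (a := -b)
    (fun i hi j l => extVanish_of_isZero_left (isZero_opcycles T (hab _ (.inr (by lia))))) hP l

/-- A minimal tilting complex cannot be exact at its last non-zero term if the kernel of the last
differential has no extensions by standard objects. -/
lemma isZero_last {i j : ℤ} (hij : i + 1 = j) (hj : IsZero (T.homology j))
    (hj' : IsZero (T.X (j + 1))) (h : ∀ l, ExtVanish 1 (H.Δ l) (T.cycles i)) :
    IsZero (T.X j) := by
  subst hij
  obtain ⟨s, hs⟩ := (H.extVanish_of_hasDeltaFiltration (hT.tilting (i + 1)).1 h).exists_lift
    (shortExact_last T rfl rfl hj' hj) (𝟙 _)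
  exact (hT.minimal i).isZero_of_section (hT.tilting (i + 1)) s hs

/-- A minimal tilting complex cannot be exact at its first non-zero term if the cokernel of the
first differential has no extensions by costandard objects. -/
lemma isZero_first {i : ℤ} (hi : IsZero (T.homology i))
    (hi' : IsZero (T.X (i - 1))) (h : ∀ l, ExtVanish 1 (T.opcycles (i + 1)) (H.nabla l)) :
    IsZero (T.X i) := by
  obtain ⟨r, hr⟩ := (H.extVanish_of_hasNablaFiltration (hT.tilting i).2 h).exists_extend
    (shortExact_first T rfl (sub_add_cancel i 1) hi' hi) (𝟙 _)
  exact (hT.minimal i).isZero_of_retraction (hT.tilting i) r hr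

lemma not_isZero_X_zero (hM : ¬ IsZero M) : ¬ IsZero (T.X 0) := fun h =>
  hM ((_root_.isZero_homology T h).of_iso hT.nonempty_homology_iso.some.symm)

lemma exists_isGreatest (h : ∃ i, ¬ IsZero (T.X i)) :
    ∃ n, IsGreatest {i : ℤ | ¬ IsZero (T.X i)} n := by
  obtain ⟨a, b, hab⟩ := hT.bounded
  obtain ⟨n, hn, hn'⟩ := Int.exists_greatest_of_bdd (P := fun i => ¬ IsZero (T.X i))
    ⟨b, fun i hi => not_lt.1 fun h => hi (hab i (.inr h))⟩ h
  exact ⟨n, hn, fun i hi => hn' i hi⟩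

lemma exists_isLeast (h : ∃ i, ¬ IsZero (T.X i)) :
    ∃ n, IsLeast {i : ℤ | ¬ IsZero (T.X i)} n := by
  obtain ⟨a, b, hab⟩ := hT.bounded
  obtain ⟨n, hn, hn'⟩ := Int.exists_least_of_bdd (P := fun i => ¬ IsZero (T.X i))
    ⟨a, fun i hi => not_lt.1 fun h => hi (hab i (.inl h))⟩ h
  exact ⟨n, hn, fun i hi => hn' i hi⟩

/-- Here the complex is exact everywhere, so a last non-zero term would split off. -/
lemma isZero_X_of_isZero (hM : IsZero M) (i : ℤ) : IsZero (T.X i) := by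
  by_contra hi
  obtain ⟨n, hn, hmax⟩ := hT.exists_isGreatest ⟨i, hi⟩
  have h0 : IsZero (T.homology 0) := hM.of_iso hT.nonempty_homology_iso.some
  refine hn (hT.isZero_last (sub_add_cancel n 1) ?_ ?_ (hT.extVanish_cycles
    fun _ l => extVanish_of_isZero_right h0))
  · by_cases hn0 : n = 0
    · rwa [hn0]
    · exact hT.isZero_homology hn0
  · by_contra h
    have : n + 1 ≤ n := hmax h
    lia

lemma isGreatest_nablaDegrees (hM : ¬ IsZero M) {n : ℕ}
    (hn : IsGreatest {i : ℤ | ¬ IsZero (T.X i)} n) : IsGreatest (H.nablaDegrees M) n := by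
  obtain ⟨e⟩ := hT.nonempty_homology_iso
  have hz : ∀ i : ℤ, n < i → IsZero (T.X i) := fun i hi => by
    by_contra h
    exact (hn.2 h).not_gt hi
  refine ⟨H.mem_nablaDegrees_iff.2 fun h => ?_, fun d hd => ?_⟩
  -- In degree 0 a non-zero `M` receives a non-zero map from some `Δ l`. In degree `m + 1`,
  -- vanishing would shift to `Ext^1` into the cycles of degree `m` and split the last differential.
  · obtain _ | m := n
    · exact hM (H.eq_zero_of_extVanish_Δ_zero h)
    · refine hn.1 (hT.isZero_last (i := m) (by simp) (hT.isZero_homology (by simp; lia))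
        (hz _ (by lia)) (hT.extVanish_cycles fun _ l => ?_))
      simpa using (h l).of_iso_right e
  · by_contra! hnd
    exact H.mem_nablaDegrees_iff.1 hd fun l =>
      (hT.extVanish_homology_Δ hz (by lia) (by lia) l).of_iso_right e.symm

lemma isGreatest_deltaDegrees (hM : ¬ IsZero M) {n : ℕ}
    (hn : IsLeast {i : ℤ | ¬ IsZero (T.X i)} (-n)) : IsGreatest (H.deltaDegrees M) n := by
  obtain ⟨e⟩ := hT.nonempty_homology_iso
  have hz : ∀ i : ℤ, i < -n → IsZero (T.X i) := fun i hi => by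
    by_contra h
    exact (hn.2 h).not_gt hi
  refine ⟨H.mem_deltaDegrees_iff.2 fun h => ?_, fun d hd => ?_⟩
  · obtain _ | m := n
    · exact hM (H.eq_zero_of_extVanish_nabla_zero h)
    · refine hn.1 (hT.isZero_first (hT.isZero_homology (by simp; lia)) (hz _ (by lia)) ?_)
      have := hT.extVanish_opcycles (n := m) fun _ l => by simpa using (h l).of_iso_left e
      rwa [show -((m + 1 : ℕ) : ℤ) + 1 = -m by lia]
  · by_contra! hnd
    exact H.mem_deltaDegrees_iff.1 hd fun l =>
      (hT.extVanish_homology_nabla (n := n) (fun i hi => hz _ (by lia)) (by lia) (by lia)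
        l).of_iso_left e.symm

lemma isGreatest_nablaDim (hM : ¬ IsZero M) : IsGreatest (H.nablaDegrees M) (H.nablaDim M) ∧
    IsGreatest {i : ℤ | ¬ IsZero (T.X i)} (H.nablaDim M : ℤ) := by
  obtain ⟨n, hn⟩ := hT.exists_isGreatest ⟨0, hT.not_isZero_X_zero hM⟩
  obtain ⟨n, rfl⟩ := Int.eq_ofNat_of_zero_le (hn.2 (hT.not_isZero_X_zero hM))
  have h := hT.isGreatest_nablaDegrees hM hn
  have hdim : H.nablaDim M = n := h.csSup_eq
  rw [hdim]
  exact ⟨h, hn⟩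

lemma isGreatest_deltaDim (hM : ¬ IsZero M) : IsGreatest (H.deltaDegrees M) (H.deltaDim M) ∧
    IsLeast {i : ℤ | ¬ IsZero (T.X i)} (-(H.deltaDim M : ℤ)) := by
  obtain ⟨n, hn⟩ := hT.exists_isLeast ⟨0, hT.not_isZero_X_zero hM⟩
  obtain ⟨n, rfl⟩ := Int.exists_eq_neg_ofNat (hn.2 (hT.not_isZero_X_zero hM))
  have h := hT.isGreatest_deltaDegrees hM hn
  have hdim : H.deltaDim M = n := h.csSup_eq
  rw [hdim]
  exact ⟨h, hn⟩

/-- For `M ≠ 0` both sides amount to `H.deltaDim M = 0`. -/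
lemma hasDeltaFiltration_iff : H.HasDeltaFiltration M ↔ ∀ i : ℤ, i < 0 → IsZero (T.X i) := by
  by_cases hM : IsZero M
  · exact iff_of_true (H.hasDeltaFiltration_of_extVanish fun _ => extVanish_of_isZero_left hM)
      fun i _ => hT.isZero_X_of_isZero hM i
  obtain ⟨h₁, h₂⟩ := hT.isGreatest_deltaDim hM
  refine ⟨fun h i hi => ?_, fun h => ?_⟩
  · have h0 : H.deltaDim M = 0 := by
      by_contra hd
      obtain ⟨d, hd⟩ := Nat.exists_eq_succ_of_ne_zero hd
      rw [hd] at h₁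
      exact H.mem_deltaDegrees_iff.1 h₁.1 fun l => H.extVanish_of_acyclic
        (H.nablaAcyclic_nabla l) d _ (H.deltaAcyclic_of_hasDeltaFiltration h)
    by_contra hi'
    have := h₂.2 hi'
    lia
  · have h0 : H.deltaDim M = 0 := by
      by_contra hd
      exact h₂.1 (h _ (by lia))
    refine H.hasDeltaFiltration_of_extVanish fun l => ?_
    by_contra hl
    have := h₁.2 (H.mem_deltaDegrees_iff.2 fun h' => hl (h' l))
    lia

end IsMinimalTiltingComplex

end HighestWeightCategory

theorem mainTheorem8 {k : Type*} [Field k] {C : Type u} [Category.{v} C] [Abelian C] [Linear k C]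
    [HasExt.{w} C] [HasDerivedCategory.{w'} C] {Λ : Type*} [PartialOrder Λ]
    (H : HighestWeightCategory k C Λ) (M : C) (T : CochainComplex C ℤ)
    (hT : H.IsMinimalTiltingComplex M T) :
    (¬ IsZero M →
      (IsGreatest (H.nablaDegrees M) (H.nablaDim M) ∧
        IsGreatest {i : ℤ | ¬ IsZero (T.X i)} (H.nablaDim M : ℤ)) ∧
      (IsGreatest (H.deltaDegrees M) (H.deltaDim M) ∧
        IsLeast {i : ℤ | ¬ IsZero (T.X i)} (-(H.deltaDim M : ℤ)))) ∧
    (H.HasDeltaFiltration M ↔ ∀ i : ℤ, i < 0 → IsZero (T.X i)) :=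
  ⟨fun hM => ⟨hT.isGreatest_nablaDim hM, hT.isGreatest_deltaDim hM⟩, hT.hasDeltaFiltration_iff⟩
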